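/- For positive integers $\ell,k$ let $r(\ell,k)$ be the Ramsey number, i.e. the smallest positive integer $n$ such that every red-blue colouring of the edges of $K_n$ contains a red $K_\ell$ or a blue $K_k$. Let $\mathsf{Er}(\ell,k)$ be the lower bound for $r(\ell,k)$ given by Erdős's first-moment argument: $\mathsf{Er}(\ell,k)=N+1$, where $N$ is the largest integer $n\ge 0$ such that $$\binom{n}{\ell}p^{\binom{\ell}{2}}+\binom{n}{k}(1-p)^{\binom{k}{2}}<1\quad\text{for some } p\in[0,1]$$ (for such $n$ some red-blue colouring of $K_n$ has no red $K_\ell$ and no blue $K_k$, so that $r(\ell,k)\ge n+1$). Then for every $\delta\in(0,1/2)$ there exists $c_\delta>0$ such that $$r(\ell,k)\ \ge\ (1+c_\delta)^{\ell}\cdot \mathsf{Er}(\ell,k)$$ for all positive integers $\ell,k$ with $\delta\le \ell/k\le 1-\delta$ and $\ell\ge 1/c_\delta$. -/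

import Mathlib

/-- The Ramsey number `r(ℓ, k)`: the least positive `n` such that every red-blue colouring of the
edges of the complete graph on `n` vertices has a red clique on `ℓ` vertices or a blue clique on
`k` vertices. A colouring is given by the graph `R` of its red edges; its blue edges are then the
edges of the complement `Rᶜ`. -/
noncomputable def ramseyNumber (l k : ℕ) : ℕ :=
  sInf {n : ℕ | 0 < n ∧ ∀ R : SimpleGraph (Fin n),
    (∃ s : Finset (Fin n), R.IsNClique l s) ∨ (∃ s : Finset (Fin n), Rᶜ.IsNClique k s)}

/-- The expected number of red cliques on `ℓ` vertices plus the expected number of blue cliques on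
`k` vertices, when each edge of the complete graph on `n` vertices is coloured independently, red
with probability `p` and blue with probability `1 - p`. -/
noncomputable def firstMoment (l k n : ℕ) (p : ℝ) : ℝ :=
  (n.choose l : ℝ) * p ^ (l.choose 2) + (n.choose k : ℝ) * (1 - p) ^ (k.choose 2)

/-- The numbers `n` of vertices for which the first moment method, with some edge probability `p`,
provides a colouring without red `ℓ`-clique and without blue `k`-clique, so that `r(ℓ, k) > n`. -/
def firstMomentSet (l k : ℕ) : Set ℕ :=
  {n : ℕ | ∃ p : ℝ, 0 ≤ p ∧ p ≤ 1 ∧ firstMoment l k n p < 1}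

/-- The lower bound for `r(ℓ, k)` obtained from Erdős's first moment argument: `r(ℓ, k) ≥ n + 1`
for the largest `n` to which the argument applies. -/
noncomputable def erdosBound (l k : ℕ) : ℕ :=
  sSup (firstMomentSet l k) + 1

theorem zero_mem_firstMomentSet {l k : ℕ} (hl : 0 < l) (hk : 0 < k) :
    0 ∈ firstMomentSet l k := by
  refine ⟨0, le_refl _, zero_le_one, ?_⟩
  simp [firstMoment, Nat.choose_eq_zero_of_lt hl, Nat.choose_eq_zero_of_lt hk]

theorem lt_of_choose_mul_half_lt {n l : ℕ} (hl : 0 < l)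
    (h : (n.choose l : ℝ) * (1 / 2 : ℝ) ^ (l.choose 2) < 1) :
    n < l + 2 ^ (l.choose 2) := by
  by_contra! hn
  have h1 : n - l + 1 ≤ n.choose l := by
    obtain ⟨d, rfl⟩ : ∃ d, n = l + d := 
      Nat.exists_eq_add_of_le (le_trans (Nat.le_add_right _ _) hn)
    obtain ⟨m, rfl⟩ : ∃ m, l = m + 1 := ⟨l - 1, by omega⟩
    clear h hn hl
    induction d with
    | zero => simp
    | succ d ih =>
      have h2 : (m + 1 + (d + 1)).choose (m + 1)
          = (m + 1 + d).choose m + (m + 1 + d).choose (m + 1) := Nat.choose_succ_succ _ _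
      have h3 : 0 < (m + 1 + d).choose m := Nat.choose_pos (by omega)
      omega
  have h2 : 2 ^ (l.choose 2) ≤ n.choose l := by omega
  have h3 : (2 : ℝ) ^ (l.choose 2) ≤ (n.choose l : ℝ) := by exact_mod_cast h2
  have h4 : (2 : ℝ) ^ (l.choose 2) * (1 / 2 : ℝ) ^ (l.choose 2) = 1 := by
    rw [← mul_pow]; norm_num
  have h5 : (0 : ℝ) ≤ (1 / 2 : ℝ) ^ (l.choose 2) := by positivity
  nlinarith [mul_le_mul_of_nonneg_right h3 h5]

/-- The supremum in `erdosBound` is over a bounded set. -/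
theorem bddAbove_firstMomentSet {l k : ℕ} (hl : 0 < l) (hk : 0 < k) :
    BddAbove (firstMomentSet l k) := by
  refine ⟨(l + 2 ^ (l.choose 2)) + (k + 2 ^ (k.choose 2)), ?_⟩
  rintro n ⟨p, hp0, hp1, hf⟩
  unfold firstMoment at hf
  have hq0 : 0 ≤ 1 - p := by linarith
  have hA : 0 ≤ (n.choose l : ℝ) * p ^ (l.choose 2) := by positivity
  have hB : 0 ≤ (n.choose k : ℝ) * (1 - p) ^ (k.choose 2) := by positivity
  rcases le_total (1 / 2 : ℝ) p with h | h
  · have hx : 0 < 2 ^ (k.choose 2) := by positivity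
    have h1 : (n.choose l : ℝ) * (1 / 2 : ℝ) ^ (l.choose 2)
        ≤ (n.choose l : ℝ) * p ^ (l.choose 2) := by gcongr
    have := lt_of_choose_mul_half_lt (n := n) hl (by linarith)
    omega
  · have hx : 0 < 2 ^ (l.choose 2) := by positivity
    have h1 : (n.choose k : ℝ) * (1 / 2 : ℝ) ^ (k.choose 2)
        ≤ (n.choose k : ℝ) * (1 - p) ^ (k.choose 2) := by
      have : (1 / 2 : ℝ) ≤ 1 - p := by linarith
      gcongr
    have := lt_of_choose_mul_half_lt (n := n) hk (by linarith)
    omega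

theorem isGreatest_sSup_firstMomentSet {l k : ℕ} (hl : 0 < l) (hk : 0 < k) :
    IsGreatest (firstMomentSet l k) (sSup (firstMomentSet l k)) :=
  ⟨Nat.sSup_mem ⟨0, zero_mem_firstMomentSet hl hk⟩ (bddAbove_firstMomentSet hl hk),
    fun _ hn => le_csSup (bddAbove_firstMomentSet hl hk) hn⟩

/-! The independent random colouring is replaced by a random geometric one. Vertices carry
independent standard Gaussian vectors in dimension `(D k)²`, with `D` a large constant, and a pair
is red when its inner product divided by `D k` is at most `-(a - η/D)`. Normalised inner products
are almost independent standard Gaussians. With `Q` the Gaussian tail, `λ = l/k` and `p = Q(a)`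
chosen so that `1 - p = p^λ`, the leading terms of the clique probabilities are those of Erdős's
argument at its balanced edge probability.

The dependence between edges enters at third order. Let `b₁ = φ(a)/p` and `b₂ = φ(a)/(1-p)` be the
hazard rates at `a` and `-a`, with `φ` the Gaussian density. Negative correlations are hard to have
all at once and positive ones are easy, so the log-probability bound changes by about `-b₁³
l³/(6Dk)` for a red clique and by `+b₂³ k³/(6Dk)` for a blue one. Shifting the threshold by `η/D`
changes them by `+l² b₁ η/(2D)` and `-k² b₂ η/(2D)`. Both totals are negative when `b₂²/3 < η < λ
b₁²/3`, and `η` is taken to be the midpoint. This interval is nonempty because `p² (-log p) < (1-p)²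
(-log(1-p))` for `p < 1/2` (`sq_mul_neg_log_lt`); compactness makes its length uniform in `λ`
(`exists_balanced_threshold`). Each clique probability thus gains a factor exponential in the square
of the clique size, which pays for `(1+c)^l` times as many vertices.

The clique bound `HasTailBound.measure_inner_ge_le` is proved by exposing the vectors one at a time.
It rests on log-concavity of the Gaussian tail: the bound is log-linear in the thresholds, so
conditioning on one coordinate of each remaining vector only produces a quadratic exponential
weight, which the two column lemmas integrate. -/

open MeasureTheory ProbabilityTheory Set Filter
open scoped ENNReal NNReal

/-! ### The Gaussian tail and its exponential majorants -/

/-- The upper tail function of the standard Gaussian distribution. -/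
noncomputable def gaussianTail (t : ℝ) : ℝ := (gaussianReal 0 1).real (Ici t)

/-- The standard Gaussian density. -/
noncomputable def gaussianDensity (t : ℝ) : ℝ := gaussianPDFReal 0 1 t

theorem gaussianDensity_eq (t : ℝ) :
    gaussianDensity t = (√(2 * Real.pi))⁻¹ * Real.exp (-t ^ 2 / 2) := by
  simp [gaussianDensity, gaussianPDFReal]

theorem gaussianDensity_pos (t : ℝ) : 0 < gaussianDensity t :=
  gaussianPDFReal_pos _ _ _ one_ne_zero

theorem continuous_gaussianDensity : Continuous gaussianDensity := by
  have : gaussianDensity = fun t => (√(2 * Real.pi))⁻¹ * Real.exp (-t ^ 2 / 2) :=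
    funext gaussianDensity_eq
  rw [this]; fun_prop

theorem gaussianDensity_le_one (t : ℝ) : gaussianDensity t ≤ 1 := by
  rw [gaussianDensity_eq]
  have h1 : (√(2 * Real.pi))⁻¹ ≤ 1 := by
    apply inv_le_one_of_one_le₀
    rw [Real.one_le_sqrt]
    nlinarith [Real.pi_gt_three]
  have h2 : Real.exp (-t ^ 2 / 2) ≤ 1 := by
    rw [Real.exp_le_one_iff]; nlinarith [sq_nonneg t]
  exact mul_le_one₀ h1 (Real.exp_pos _).le h2

theorem hasDerivAt_gaussianDensity (t : ℝ) :
    HasDerivAt gaussianDensity (-t * gaussianDensity t) t := by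
  have h : HasDerivAt (fun t : ℝ => (√(2 * Real.pi))⁻¹ * Real.exp (-t ^ 2 / 2))
      ((√(2 * Real.pi))⁻¹ * (Real.exp (-t ^ 2 / 2) * (-(2 * t) / 2))) t := by
    have h0 : HasDerivAt (fun t : ℝ => -t ^ 2 / 2) (-(2 * t) / 2) t := by
      simpa using ((hasDerivAt_pow 2 t).neg).div_const 2
    exact (h0.exp).const_mul _
  have e : gaussianDensity = fun t => (√(2 * Real.pi))⁻¹ * Real.exp (-t ^ 2 / 2) :=
    funext gaussianDensity_eq
  rw [e]
  convert h using 1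
  ring

theorem gaussianTail_eq_integral (t : ℝ) :
    gaussianTail t = ∫ x in Ici t, gaussianDensity x := by
  rw [gaussianTail, measureReal_def, gaussianReal_apply_eq_integral _ one_ne_zero,
    ENNReal.toReal_ofReal]
  · rfl
  · exact setIntegral_nonneg measurableSet_Ici fun x _ => (gaussianDensity_pos x).le

theorem integrable_gaussianDensity : Integrable gaussianDensity :=
  integrable_gaussianPDFReal 0 1

theorem gaussianTail_eq_sub (t : ℝ) :
    gaussianTail t = gaussianTail 0 - ∫ x in (0 : ℝ)..t, gaussianDensity x := by
  simp only [gaussianTail_eq_integral, integral_Ici_eq_integral_Ioi]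
  have := intervalIntegral.integral_interval_add_Ioi
    (integrable_gaussianDensity.integrableOn (s := Ioi 0))
    (integrable_gaussianDensity.integrableOn (s := Ioi t))
  linarith

theorem hasDerivAt_gaussianTail (t : ℝ) :
    HasDerivAt gaussianTail (-gaussianDensity t) t := by
  have h := intervalIntegral.integral_hasDerivAt_right (a := 0) (b := t)
    (continuous_gaussianDensity.intervalIntegrable _ _)
    continuous_gaussianDensity.stronglyMeasurable.stronglyMeasurableAtFilter
    continuous_gaussianDensity.continuousAt
  have e : gaussianTail = fun t => gaussianTail 0 - ∫ x in (0 : ℝ)..t, gaussianDensity x :=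
    funext gaussianTail_eq_sub
  rw [e]
  exact h.const_sub _

theorem continuous_gaussianTail : Continuous gaussianTail :=
  continuous_iff_continuousAt.2 fun t => (hasDerivAt_gaussianTail t).continuousAt

theorem gaussianTail_pos (t : ℝ) : 0 < gaussianTail t := by
  rw [gaussianTail, measureReal_def]
  refine ENNReal.toReal_pos (fun h => ?_) (measure_ne_top _ _)
  have := gaussianReal_absolutelyContinuous' 0 (one_ne_zero : (1 : ℝ≥0) ≠ 0) h
  simp at this

theorem gaussianTail_le_one (t : ℝ) : gaussianTail t ≤ 1 := measureReal_le_one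

theorem gaussianTail_neg (t : ℝ) : gaussianTail (-t) = 1 - gaussianTail t := by
  have h1 : gaussianTail (-t) = (gaussianReal 0 1).real (Iic t) := by
    have h := gaussianReal_map_neg (μ := 0) (v := 1)
    rw [neg_zero] at h
    rw [gaussianTail, ← h, map_measureReal_apply measurable_neg measurableSet_Ici, h]
    congr 1
    ext x; simp
  have h2 : (gaussianReal 0 1).real (Iic t) = (gaussianReal 0 1).real (Iio t) := by
    have := nullSingletonClass_gaussianReal (μ := 0) (one_ne_zero : (1 : ℝ≥0) ≠ 0)
    exact measureReal_congr Iio_ae_eq_Iic.symm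
  rw [h1, h2, gaussianTail, ← probReal_compl_eq_one_sub measurableSet_Ici, compl_Ici]

theorem gaussianTail_zero : gaussianTail 0 = 1 / 2 := by
  have := gaussianTail_neg 0
  rw [neg_zero] at this
  linarith

theorem gaussianTail_le_exp {t : ℝ} (ht : 0 ≤ t) :
    gaussianTail t ≤ Real.exp (-t ^ 2 / 2) := by
  have h := measure_ge_le_exp_mul_mgf (μ := gaussianReal 0 1) (X := id) t ht
    (integrable_exp_mul_gaussianReal t)
  rw [mgf_id_gaussianReal, ← Real.exp_add] at h
  refine h.trans (Real.exp_le_exp.2 ?_)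
  simp; ring_nf; rfl

/-- The Mills ratio inequality. -/
theorem mul_gaussianTail_le_gaussianDensity (t : ℝ) :
    t * gaussianTail t ≤ gaussianDensity t := by
  have hd : ∀ x, HasDerivAt (fun x => gaussianDensity x - x * gaussianTail x)
      (-gaussianTail x) x := by
    intro x
    have := (hasDerivAt_gaussianDensity x).sub ((hasDerivAt_id' x).mul (hasDerivAt_gaussianTail x))
    exact this.congr_deriv (by ring)
  have hanti : Antitone (fun x => gaussianDensity x - x * gaussianTail x) :=
    antitone_of_deriv_nonpos (fun x => (hd x).differentiableAt)
      (fun x => by rw [(hd x).deriv]; linarith [gaussianTail_pos x])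
  by_contra! hlt
  set c := t * gaussianTail t - gaussianDensity t with hc
  have hc0 : 0 < c := by linarith
  -- The function `φ(x) - x Q(x)` is decreasing, so a value `-c < 0` at `t` forces `x Q(x) ≥ c` for
  -- all larger `x`. At `x ≥ 4/c` this contradicts `x² Q(x) ≤ 2`, a consequence of the Chernoff
  -- bound.
  set x := max (max t 1) (4 / c) with hx
  have hxt : t ≤ x := le_trans (le_max_left _ _) (le_max_left _ _)
  have hx1 : 1 ≤ x := le_trans (le_max_right t 1) (le_max_left _ _)
  have hxc : 4 / c ≤ x := le_max_right _ _
  have h1 := hanti hxt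
  simp only at h1
  have h2 := gaussianTail_le_exp (show 0 ≤ x by linarith)
  have h3 : Real.exp (-x ^ 2 / 2) * (x ^ 2 / 2) ≤ 1 := by
    have := Real.add_one_le_exp (x ^ 2 / 2)
    have e : Real.exp (-x ^ 2 / 2) * Real.exp (x ^ 2 / 2) = 1 := by
      rw [← Real.exp_add]; simp [neg_div]
    nlinarith [Real.exp_pos (-x ^ 2 / 2)]
  have h4 := gaussianDensity_pos x
  have h5 : c ≤ x * gaussianTail x := by linarith
  have h6 : 4 ≤ x * c := by
    rw [div_le_iff₀ hc0] at hxc; linarith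
  have h7 : x * c ≤ x * (x * gaussianTail x) := by gcongr
  have h8 : x ^ 2 / 2 * gaussianTail x ≤ 1 := by
    refine le_trans ?_ h3
    rw [mul_comm]; gcongr
  nlinarith

/-- The hazard rate of the standard Gaussian distribution. -/
noncomputable def gaussianHazard (t : ℝ) : ℝ := gaussianDensity t / gaussianTail t

theorem gaussianHazard_pos (t : ℝ) : 0 < gaussianHazard t :=
  div_pos (gaussianDensity_pos t) (gaussianTail_pos t)

theorem monotone_gaussianHazard : Monotone gaussianHazard := by
  have hd : ∀ x, HasDerivAt gaussianHazard
      ((-x * gaussianDensity x * gaussianTail x - gaussianDensity x * -gaussianDensity x)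
        / gaussianTail x ^ 2) x := fun x =>
    (hasDerivAt_gaussianDensity x).div (hasDerivAt_gaussianTail x) (gaussianTail_pos x).ne'
  refine monotone_of_deriv_nonneg (fun x => (hd x).differentiableAt) fun x => ?_
  rw [(hd x).deriv]
  refine div_nonneg ?_ (sq_nonneg _)
  nlinarith [mul_gaussianTail_le_gaussianDensity x, gaussianDensity_pos x]

/-- Log-concavity of the Gaussian tail, as a tangent line bound. -/
theorem gaussianTail_le_tangent (a t : ℝ) :
    gaussianTail t ≤ Real.exp (Real.log (gaussianTail a) + gaussianHazard a * a
      - gaussianHazard a * t) := by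
  have hd : ∀ x, HasDerivAt (fun x => Real.log (gaussianTail x) + gaussianHazard a * x)
      (-gaussianHazard x + gaussianHazard a) x := by
    intro x
    have h1 := (hasDerivAt_gaussianTail x).log (gaussianTail_pos x).ne'
    have h2 := h1.add ((hasDerivAt_id' x).const_mul (gaussianHazard a))
    exact h2.congr_deriv (by simp [gaussianHazard, neg_div])
  have hcont : Continuous (fun x => Real.log (gaussianTail x) + gaussianHazard a * x) :=
    continuous_iff_continuousAt.2 fun x => (hd x).continuousAt
  have hmain : Real.log (gaussianTail t) + gaussianHazard a * t
      ≤ Real.log (gaussianTail a) + gaussianHazard a * a := by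
    rcases le_total t a with h | h
    · refine monotoneOn_of_deriv_nonneg (convex_Iic a) hcont.continuousOn
        (fun x _ => (hd x).differentiableAt.differentiableWithinAt) (fun x hx => ?_)
        (show t ∈ Iic a from h) self_mem_Iic h
      rw [(hd x).deriv]
      rw [interior_Iic] at hx
      linarith [monotone_gaussianHazard (le_of_lt hx)]
    · refine antitoneOn_of_deriv_nonpos (convex_Ici a) hcont.continuousOn
        (fun x _ => (hd x).differentiableAt.differentiableWithinAt) (fun x hx => ?_)
        self_mem_Ici (show t ∈ Ici a from h) h
      rw [(hd x).deriv]
      rw [interior_Ici] at hx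
      linarith [monotone_gaussianHazard (le_of_lt hx)]
  rw [← Real.log_le_iff_le_exp (gaussianTail_pos t)]
  linarith

theorem gaussianTail_le_exp_sq (s t : ℝ) (hs : 0 ≤ s) :
    gaussianTail t ≤ Real.exp (s ^ 2 / 2 - s * t) := by
  rcases le_total 0 t with ht | ht
  · refine (gaussianTail_le_exp ht).trans (Real.exp_le_exp.2 ?_)
    nlinarith [sq_nonneg (s - t)]
  · refine (gaussianTail_le_one t).trans (Real.one_le_exp ?_)
    nlinarith [mul_nonneg hs (neg_nonneg.2 ht), sq_nonneg s]

/-- `HasTailBound b κ C` says that the tail function of the standard Gaussian lies below the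
exponentials of the lines of slope `-s`, `s ≥ 0`, with intercept close to `κ` for `s` close
to `b`. -/
def HasTailBound (b κ C : ℝ) : Prop :=
  ∀ s t : ℝ, 0 ≤ s → gaussianTail t ≤ Real.exp (κ + C * |s ^ 2 - b ^ 2| - s * t)

/-- A line of slope `-s` is obtained as a convex combination of lines already known to dominate `log
Q`: the tangent and the zero line when `s ≤ b`, the tangent and the Chernoff line of slope `-2s`
when `s ≥ b`. The weight of the second line is small with `|s² - b²|`, which bounds the loss in the
intercept. -/
theorem hasTailBound_of_tangent {b κ : ℝ} (hb : 0 < b)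
    (h : ∀ t, gaussianTail t ≤ Real.exp (κ - b * t)) :
    HasTailBound b κ (2 + |κ| / b ^ 2) := by
  intro s t hs
  have hQ := gaussianTail_pos t
  have hlog : Real.log (gaussianTail t) ≤ κ - b * t := (Real.log_le_iff_le_exp hQ).2 (h t)
  have hlog0 : Real.log (gaussianTail t) ≤ 0 := Real.log_nonpos hQ.le (gaussianTail_le_one t)
  rw [← Real.log_le_iff_le_exp hQ]
  rcases le_total s b with hsb | hsb
  · have h1 : s / b * Real.log (gaussianTail t) ≤ s / b * (κ - b * t) := by gcongr
    have h2 : (1 - s / b) * Real.log (gaussianTail t) ≤ 0 := by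
      refine mul_nonpos_of_nonneg_of_nonpos ?_ hlog0
      rw [sub_nonneg, div_le_one hb]; exact hsb
    have h3 : s / b * (κ - b * t) = s / b * κ - s * t := by field_simp
    have habs : |s ^ 2 - b ^ 2| = b ^ 2 - s ^ 2 := by
      rw [abs_of_nonpos (by nlinarith)]; ring
    have h4 : s / b * κ ≤ κ + |κ| * (1 - s / b) := by
      have : 0 ≤ 1 - s / b := by rw [sub_nonneg, div_le_one hb]; exact hsb
      nlinarith [neg_abs_le κ]
    have h5 : |κ| * (1 - s / b) ≤ |κ| / b ^ 2 * (b ^ 2 - s ^ 2) := by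
      have : |κ| / b ^ 2 * (b ^ 2 - s ^ 2) = |κ| * (1 - (s / b) ^ 2) := by field_simp
      rw [this]
      have h6 : s / b ≤ 1 := by rw [div_le_one hb]; exact hsb
      have h7 : 0 ≤ s / b := by positivity
      gcongr
      nlinarith
    rw [habs]
    nlinarith [mul_nonneg (show (0 : ℝ) ≤ 2 by norm_num)
      (show 0 ≤ b ^ 2 - s ^ 2 by nlinarith)]
  · have hs0 : 0 < s := by linarith
    have hlog2 : Real.log (gaussianTail t) ≤ (2 * s) ^ 2 / 2 - 2 * s * t :=
      (Real.log_le_iff_le_exp hQ).2 (gaussianTail_le_exp_sq _ _ (by linarith))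
    have hden : 0 < 2 * s - b := by linarith
    set θ := (s - b) / (2 * s - b) with hθ
    have hθ0 : 0 ≤ θ := div_nonneg (by linarith) hden.le
    have hθ1 : θ ≤ 1 := by rw [hθ, div_le_one hden]; linarith
    have hθs : (1 - θ) * b + θ * (2 * s) = s := by
      have : θ * (2 * s - b) = s - b := by rw [hθ, div_mul_cancel₀ _ hden.ne']
      linarith
    have hθ2 : θ ≤ (s - b) / s := by
      rw [hθ]; gcongr; linarith
    have h1 : (1 - θ) * Real.log (gaussianTail t) ≤ (1 - θ) * (κ - b * t) :=
      mul_le_mul_of_nonneg_left hlog (by linarith)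
    have h2 : θ * Real.log (gaussianTail t) ≤ θ * ((2 * s) ^ 2 / 2 - 2 * s * t) :=
      mul_le_mul_of_nonneg_left hlog2 hθ0
    have habs : |s ^ 2 - b ^ 2| = s ^ 2 - b ^ 2 := abs_of_nonneg (by nlinarith)
    rw [habs]
    have h3 : θ * (2 * s ^ 2) ≤ 2 * (s ^ 2 - b ^ 2) := by
      have : θ * s ≤ s - b := by
        rw [le_div_iff₀ hs0] at hθ2; exact hθ2
      nlinarith
    have h4 : θ * |κ| ≤ |κ| / b ^ 2 * (s ^ 2 - b ^ 2) := by
      have h5 : θ ≤ (s ^ 2 - b ^ 2) / b ^ 2 := by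
        refine hθ2.trans ?_
        rw [div_le_div_iff₀ hs0 (by positivity)]
        have e : (s ^ 2 - b ^ 2) * s = (s - b) * ((s + b) * s) := by ring
        rw [e]
        exact mul_le_mul_of_nonneg_left (by nlinarith) (by linarith)
      calc θ * |κ| ≤ (s ^ 2 - b ^ 2) / b ^ 2 * |κ| := by gcongr
        _ = _ := by ring
    have h6 : -(θ * κ) ≤ θ * |κ| := by nlinarith [neg_abs_le κ]
    have h7 : (1 - θ) * (κ - b * t) + θ * ((2 * s) ^ 2 / 2 - 2 * s * t)
        = κ - θ * κ + θ * (2 * s ^ 2) - ((1 - θ) * b + θ * (2 * s)) * t := by ring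
    rw [hθs] at h7
    linarith

/-- At slope `s = 0` the bound must dominate the limit 1 of the tail at `-∞`. This covers the
degenerate half-line `ρ = 0` below. -/
theorem HasTailBound.const_nonneg {b κ C : ℝ} (h : HasTailBound b κ C) :
    0 ≤ κ + C * b ^ 2 := by
  have h0 : ∀ t, gaussianTail t ≤ Real.exp (κ + C * b ^ 2) := fun t => by
    simpa using h 0 t le_rfl
  by_contra! hlt
  have h1 : ∀ t, 0 ≤ t → 1 - Real.exp (-t ^ 2 / 2) ≤ Real.exp (κ + C * b ^ 2) := fun t ht => by
    have := h0 (-t)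
    rw [gaussianTail_neg] at this
    linarith [gaussianTail_le_exp ht]
  have hlim : Tendsto (fun t : ℝ => 1 - Real.exp (-t ^ 2 / 2)) atTop (nhds (1 - 0)) := by
    refine Tendsto.const_sub _ (Real.tendsto_exp_atBot.comp ?_)
    have : Tendsto (fun t : ℝ => t ^ 2 / 2) atTop atTop :=
      (tendsto_pow_atTop two_ne_zero).atTop_div_const two_pos
    refine (tendsto_neg_atTop_atBot.comp this).congr fun t => ?_
    simp [neg_div]
  have := le_of_tendsto hlim (eventually_atTop.2 ⟨0, h1⟩)
  rw [sub_zero, Real.one_le_exp_iff] at this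
  linarith

/-! ### Product measures and Gaussian tilting -/

theorem measurePreserving_finCons {X : Type} [MeasurableSpace X] (μ : Measure X) [SigmaFinite μ]
    (n : ℕ) :
    MeasurePreserving (fun p : X × (Fin n → X) => (Fin.cons p.1 p.2 : Fin (n + 1) → X))
      (μ.prod (Measure.pi fun _ => μ)) (Measure.pi fun _ => μ) := by
  have h := (measurePreserving_piFinSuccAbove (fun _ : Fin (n + 1) => μ) 0).symm
  convert h using 1
  funext p
  simp [MeasurableEquiv.piFinSuccAbove_symm_apply]
  rfl

theorem lintegral_pi_finCons {X : Type} [MeasurableSpace X] (μ : Measure X) [SigmaFinite μ]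
    {n : ℕ} {f : (Fin (n + 1) → X) → ℝ≥0∞} (hf : Measurable f) :
    ∫⁻ x, f x ∂(Measure.pi fun _ => μ) =
      ∫⁻ a, ∫⁻ y, f (Fin.cons a y) ∂(Measure.pi fun _ : Fin n => μ) ∂μ := by
  have h := measurePreserving_finCons μ n
  rw [← h.lintegral_comp hf, lintegral_prod]
  exact (hf.comp h.measurable).aemeasurable

theorem lintegral_pi_prod_eq {X : Type} [MeasurableSpace X] (μ : Measure X) [SigmaFinite μ]
    {n : ℕ} {f : Fin n → X → ℝ≥0∞} (hf : ∀ i, Measurable (f i)) :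
    ∫⁻ x, ∏ i, f i (x i) ∂(Measure.pi fun _ : Fin n => μ) = ∏ i, ∫⁻ a, f i a ∂μ := by
  induction n with
  | zero => simp
  | succ n ih =>
    have hm : Measurable fun x : Fin (n + 1) → X => ∏ i, f i (x i) :=
      Finset.measurable_fun_prod _ fun i _ => (hf i).comp (measurable_pi_apply i)
    rw [lintegral_pi_finCons μ hm]
    simp only [Fin.prod_univ_succ, Fin.cons_zero, Fin.cons_succ]
    rw [← ih fun i => hf i.succ, ← lintegral_mul_const _ (hf 0)]
    congr 1
    funext a
    rw [lintegral_const_mul]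
    exact Finset.measurable_fun_prod _ fun i _ => (hf i.succ).comp (measurable_pi_apply i)

/-- Exponential tilting of the standard Gaussian distribution. -/
theorem lintegral_gaussian_tilt {f : ℝ → ℝ≥0∞} (hf : Measurable f) (u : ℝ) {σ : ℝ} (hσ : 0 < σ) :
    ∫⁻ z, f z * ENNReal.ofReal (Real.exp (u * z + (1 - (σ ^ 2)⁻¹) * z ^ 2 / 2)) ∂(gaussianReal 0 1)
      = ENNReal.ofReal (σ * Real.exp (u ^ 2 * σ ^ 2 / 2))
        * ∫⁻ z, f (σ * z + u * σ ^ 2) ∂(gaussianReal 0 1) := by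
  have hmap : (gaussianReal 0 1).map (fun z => σ * z + u * σ ^ 2)
      = gaussianReal (u * σ ^ 2) (.mk (σ ^ 2) (sq_nonneg _)) := by
    have h1 := gaussianReal_map_const_mul (μ := 0) (v := 1) σ
    have h2 := gaussianReal_map_add_const (μ := σ * 0) (v := .mk (σ ^ 2) (sq_nonneg _) * 1)
      (u * σ ^ 2)
    rw [← h1, Measure.map_map (by fun_prop) (by fun_prop)] at h2
    simpa [Function.comp_def] using h2
  have hv : (NNReal.mk (σ ^ 2) (sq_nonneg σ)) ≠ 0 := by
    rw [← NNReal.coe_ne_zero]; simpa using hσ.ne'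
  have hR : ∫⁻ z, f (σ * z + u * σ ^ 2) ∂(gaussianReal 0 1)
      = ∫⁻ z, f z ∂(gaussianReal (u * σ ^ 2) (.mk (σ ^ 2) (sq_nonneg _))) := by
    rw [← hmap, lintegral_map hf (by fun_prop)]
  rw [hR, gaussianReal_of_var_ne_zero _ hv, gaussianReal_of_var_ne_zero _ one_ne_zero,
    lintegral_withDensity_eq_lintegral_mul _ (measurable_gaussianPDF _ _) (by fun_prop),
    lintegral_withDensity_eq_lintegral_mul _ (measurable_gaussianPDF _ _) hf,
    ← lintegral_const_mul _ (by
      exact (measurable_gaussianPDF _ _).mul hf)]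
  congr 1
  funext z
  simp only [Pi.mul_apply, gaussianPDF]
  rw [mul_comm (f z), ← mul_assoc, ← mul_assoc, ← ENNReal.ofReal_mul (gaussianPDFReal_nonneg _ _ _),
    ← ENNReal.ofReal_mul (by positivity)]
  congr 2
  simp only [gaussianPDFReal, NNReal.coe_one, NNReal.coe_mk, mul_one, sub_zero]
  rw [Real.sqrt_mul (by positivity) (σ ^ 2), Real.sqrt_sq hσ.le, mul_assoc, ← Real.exp_add,
    show σ * Real.exp (u ^ 2 * σ ^ 2 / 2) * ((√(2 * Real.pi) * σ)⁻¹
      * Real.exp (-(z - u * σ ^ 2) ^ 2 / (2 * σ ^ 2)))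
      = (σ * (√(2 * Real.pi) * σ)⁻¹) * (Real.exp (u ^ 2 * σ ^ 2 / 2)
        * Real.exp (-(z - u * σ ^ 2) ^ 2 / (2 * σ ^ 2))) by ring, ← Real.exp_add]
  congr 1
  · field_simp
  · congr 1
    field_simp
    ring

theorem lintegral_exp_quadratic (u : ℝ) {σ : ℝ} (hσ : 0 < σ) :
    ∫⁻ z, ENNReal.ofReal (Real.exp (u * z + (1 - (σ ^ 2)⁻¹) * z ^ 2 / 2)) ∂(gaussianReal 0 1)
      = ENNReal.ofReal (σ * Real.exp (u ^ 2 * σ ^ 2 / 2)) := by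
  simpa using lintegral_gaussian_tilt (f := fun _ => 1) measurable_const u hσ

theorem lintegral_exp_linear (u : ℝ) :
    ∫⁻ z, ENNReal.ofReal (Real.exp (u * z)) ∂(gaussianReal 0 1)
      = ENNReal.ofReal (Real.exp (u ^ 2 / 2)) := by
  simpa using lintegral_exp_quadratic u one_pos

/-- The tilted measure of a half line. -/
theorem HasTailBound.lintegral_halfLine_le {b κ C : ℝ} (h : HasTailBound b κ C) (hb : 0 < b)
    {ρ σ : ℝ} (hρ : 0 ≤ ρ) (hσ : 0 < σ) (τ u : ℝ) :
    ∫⁻ z, {z : ℝ | τ ≤ ρ * z}.indicator 1 z *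
        ENNReal.ofReal (Real.exp (u * z + (1 - (σ ^ 2)⁻¹) * z ^ 2 / 2)) ∂(gaussianReal 0 1)
      ≤ ENNReal.ofReal (σ * Real.exp (u ^ 2 * σ ^ 2 / 2 + κ + C * |(b * ρ * σ) ^ 2 - b ^ 2|
          - b * τ + b * ρ * σ ^ 2 * u)) := by
  have hm : MeasurableSet {z : ℝ | τ ≤ ρ * z} :=
    measurableSet_le measurable_const (by fun_prop)
  have hm' : MeasurableSet {z : ℝ | τ ≤ ρ * (σ * z + u * σ ^ 2)} :=
    measurableSet_le measurable_const (by fun_prop)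
  rw [lintegral_gaussian_tilt (measurable_one.indicator hm) u hσ]
  have e : ∫⁻ z, {z : ℝ | τ ≤ ρ * z}.indicator 1 (σ * z + u * σ ^ 2) ∂(gaussianReal 0 1)
      = gaussianReal 0 1 {z : ℝ | τ ≤ ρ * (σ * z + u * σ ^ 2)} := by
    rw [← lintegral_indicator_one hm']
    rfl
  have key : gaussianReal 0 1 {z : ℝ | τ ≤ ρ * (σ * z + u * σ ^ 2)} ≤
      ENNReal.ofReal (Real.exp (κ + C * |(b * ρ * σ) ^ 2 - b ^ 2|
          - b * τ + b * ρ * σ ^ 2 * u)) := by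
    rcases hρ.eq_or_lt with rfl | hρ
    · by_cases hτ : τ ≤ 0
      · refine prob_le_one.trans (ENNReal.one_le_ofReal.2 (Real.one_le_exp ?_))
        have := h.const_nonneg
        simp
        nlinarith
      · simp [hτ]
    · have hs : {z : ℝ | τ ≤ ρ * (σ * z + u * σ ^ 2)} = Ici ((τ / ρ - u * σ ^ 2) / σ) := by
        ext z
        simp only [mem_ofPred_eq, mem_Ici, div_le_iff₀ hσ, sub_le_iff_le_add, div_le_iff₀ hρ]
        rw [mul_comm ρ, mul_comm σ]
      rw [hs, ← ofReal_measureReal]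
      -- The slope `bρσ` is the one for which `τ` appears exactly as `-bτ`, whatever `ρ` and `σ`
      -- are. The induction needs this exact linearity in the thresholds; the deviation of `ρσ` from
      -- 1 is absorbed by the `C` term.
      refine ENNReal.ofReal_le_ofReal ((h (b * ρ * σ) _ (by positivity)).trans
        (Real.exp_le_exp.2 (le_of_eq ?_)))
      field_simp
      ring
  rw [e]
  refine (mul_le_mul_right key _).trans (le_of_eq ?_)
  rw [← ENNReal.ofReal_mul (by positivity), mul_assoc, ← Real.exp_add]
  congr 3
  ring

/-! ### Integrating one column of coordinates -/

/-- The sum of the entries above the diagonal. -/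
def pairSum {n : ℕ} (T : Fin n → Fin n → ℝ) : ℝ := ∑ i, ∑ j ∈ Finset.Ioi i, T i j

theorem pairSum_succ {n : ℕ} (T : Fin (n + 1) → Fin (n + 1) → ℝ) :
    pairSum T = ∑ j : Fin n, T 0 j.succ + pairSum fun i j => T i.succ j.succ := by
  simp [pairSum, Fin.sum_univ_succ, Fin.sum_Ioi_succ]

theorem pairSum_sub_mul {n : ℕ} (T U : Fin n → Fin n → ℝ) (c : ℝ) :
    pairSum (fun i j => T i j - c * U i j) = pairSum T - c * pairSum U := by
  simp [pairSum, Finset.sum_sub_distrib, Finset.mul_sum]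

theorem pairSum_const (n : ℕ) (a : ℝ) :
    pairSum (fun _ _ : Fin n => a) = n * (n - 1) / 2 * a := by
  induction n with
  | zero => simp [pairSum]
  | succ n ih => rw [pairSum_succ, ih]; simp; ring

theorem pairSum_mul_self {n : ℕ} (z : Fin n → ℝ) :
    pairSum (fun i j => z i * z j) = ((∑ i, z i) ^ 2 - ∑ i, z i ^ 2) / 2 := by
  induction n with
  | zero => simp [pairSum]
  | succ n ih =>
    rw [pairSum_succ, ih fun i => z i.succ, Fin.sum_univ_succ, Fin.sum_univ_succ,
      ← Finset.mul_sum]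
    ring

theorem indicator_forall_eq_prod {n : ℕ} (S : Fin n → Set ℝ) (z : Fin n → ℝ) :
    {z : Fin n → ℝ | ∀ i, z i ∈ S i}.indicator (1 : (Fin n → ℝ) → ℝ≥0∞) z
      = ∏ i, (S i).indicator 1 (z i) := by
  by_cases h : ∀ i, z i ∈ S i
  · rw [indicator_of_mem (by exact h)]
    simp [h]
  · rw [indicator_of_notMem (by exact h)]
    push Not at h
    obtain ⟨i, hi⟩ := h
    exact (Finset.prod_eq_zero (Finset.mem_univ i) (indicator_of_notMem hi _)).symm

/-- The integral of a product of tilted half-line indicators. -/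
theorem HasTailBound.lintegral_halfLine_prod_le {b κ C : ℝ} (h : HasTailBound b κ C) (hb : 0 < b)
    {ρ σ : ℝ} (hρ : 0 ≤ ρ) (hσ : 0 < σ) {n : ℕ} (τ : Fin n → ℝ) (u : ℝ) :
    ∫⁻ z, {z : Fin n → ℝ | ∀ i, τ i ≤ ρ * z i}.indicator 1 z *
        ENNReal.ofReal (Real.exp (u * ∑ i, z i + (1 - (σ ^ 2)⁻¹) * (∑ i, z i ^ 2) / 2))
        ∂(Measure.pi fun _ => gaussianReal 0 1)
      ≤ ENNReal.ofReal (σ ^ n * Real.exp (n * (u ^ 2 * σ ^ 2 / 2 + κ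
          + C * |(b * ρ * σ) ^ 2 - b ^ 2| + b * ρ * σ ^ 2 * u) - b * ∑ i, τ i)) := by
  have e : ∀ z : Fin n → ℝ, {z : Fin n → ℝ | ∀ i, τ i ≤ ρ * z i}.indicator 1 z *
        ENNReal.ofReal (Real.exp (u * ∑ i, z i + (1 - (σ ^ 2)⁻¹) * (∑ i, z i ^ 2) / 2))
      = ∏ i, ({z : ℝ | τ i ≤ ρ * z}.indicator 1 (z i) *
        ENNReal.ofReal (Real.exp (u * z i + (1 - (σ ^ 2)⁻¹) * z i ^ 2 / 2))) := by
    intro z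
    rw [Finset.prod_mul_distrib, ← indicator_forall_eq_prod, ← ENNReal.ofReal_prod_of_nonneg
      (fun i _ => (Real.exp_pos _).le), ← Real.exp_sum, Finset.sum_add_distrib,
      ← Finset.mul_sum, ← Finset.sum_div, ← Finset.mul_sum]
    rfl
  simp_rw [e]
  rw [lintegral_pi_prod_eq (gaussianReal 0 1) (f := fun i z => {z : ℝ | τ i ≤ ρ * z}.indicator 1 z *
        ENNReal.ofReal (Real.exp (u * z + (1 - (σ ^ 2)⁻¹) * z ^ 2 / 2)))]
  · refine (Finset.prod_le_prod' fun i _ => h.lintegral_halfLine_le hb hρ hσ (τ i) u).trans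
      (le_of_eq ?_)
    rw [← ENNReal.ofReal_prod_of_nonneg (fun i _ => by positivity), Finset.prod_mul_distrib,
      ← Real.exp_sum]
    congr 2
    · simp
    · congr 1
      simp only [Finset.sum_add_distrib, Finset.sum_sub_distrib, ← Finset.mul_sum,
        Finset.sum_const, Finset.card_univ, Fintype.card_fin, nsmul_eq_mul]
      ring
  · intro i
    have hm : MeasurableSet {z : ℝ | τ i ≤ ρ * z} :=
      measurableSet_le measurable_const (by fun_prop)
    exact (measurable_one.indicator hm).mul (by fun_prop)

theorem measurable_indicator_halfSpaces {n : ℕ} (τ : Fin n → ℝ) (ρ : ℝ) :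
    Measurable ({z : Fin n → ℝ | ∀ i, τ i ≤ ρ * z i}.indicator (1 : (Fin n → ℝ) → ℝ≥0∞)) := by
  refine measurable_one.indicator ?_
  rw [ofPred_forall]
  exact MeasurableSet.iInter fun i => measurableSet_le measurable_const (by fun_prop)

theorem exists_sq_inv_eq_one_sub {x : ℝ} (hx : x < 1) :
    ∃ σ : ℝ, 0 < σ ∧ σ ^ 2 * (1 - x) = 1 ∧ 1 - (σ ^ 2)⁻¹ = x := by
  have h : 0 < 1 - x := by linarith
  have e : √((1 - x)⁻¹) ^ 2 = (1 - x)⁻¹ := Real.sq_sqrt (by positivity)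
  refine ⟨√((1 - x)⁻¹), by positivity, ?_, ?_⟩
  · rw [e]; field_simp
  · rw [e, inv_inv]; ring

/-- With `S = ∑ z i`, the pair sum is at most `S²/2`, and `exp(β S²/2)` is the mean of `exp(√β g S)`
over an auxiliary standard Gaussian `g`. For fixed `g` the coordinates separate; integrating over
`g` afterwards gives the main term `n² b² β/2`. -/
theorem HasTailBound.lintegral_column_le_of_pos {b κ C : ℝ} (h : HasTailBound b κ C) (hb : 0 < b)
    (hC : 0 ≤ C) {ρ β : ℝ} (hρ : 0 ≤ ρ) (hβ : 0 ≤ β) {n : ℕ} (hn : n * β ≤ 1 / 2)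
    (τ : Fin n → ℝ) :
    ∫⁻ z, {z : Fin n → ℝ | ∀ i, τ i ≤ ρ * z i}.indicator 1 z *
        ENNReal.ofReal (Real.exp (β * pairSum fun i j => z i * z j))
        ∂(Measure.pi fun _ => gaussianReal 0 1)
      ≤ ENNReal.ofReal (Real.exp (1 + C * b ^ 2 + n * κ - b * ∑ i, τ i + n ^ 2 * b ^ 2 * β / 2
          + n ^ 3 * b ^ 2 * β ^ 2 + n * ((2 * C + 1) * b ^ 2) * |ρ ^ 2 - 1|)) := by
  have hind := measurable_indicator_halfSpaces τ ρ
  have h1 : ∀ z : Fin n → ℝ, {z : Fin n → ℝ | ∀ i, τ i ≤ ρ * z i}.indicator 1 z *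
        ENNReal.ofReal (Real.exp (β * pairSum fun i j => z i * z j))
      ≤ ∫⁻ g, {z : Fin n → ℝ | ∀ i, τ i ≤ ρ * z i}.indicator 1 z *
        ENNReal.ofReal (Real.exp (√β * g * ∑ i, z i)) ∂(gaussianReal 0 1) := by
    intro z
    rw [lintegral_const_mul _ (by fun_prop)]
    gcongr
    have e : ∀ g : ℝ, √β * g * ∑ i, z i = (√β * ∑ i, z i) * g := fun g => by ring
    simp_rw [e]
    rw [lintegral_exp_linear, mul_pow, Real.sq_sqrt hβ, pairSum_mul_self]
    refine ENNReal.ofReal_le_ofReal (Real.exp_le_exp.2 ?_)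
    have : 0 ≤ ∑ i, z i ^ 2 := Finset.sum_nonneg fun i _ => sq_nonneg _
    nlinarith [mul_nonneg hβ this]
  refine (lintegral_mono h1).trans ?_
  rw [lintegral_lintegral_swap]
  swap
  · refine Measurable.aemeasurable ?_
    exact (hind.comp measurable_fst).mul (by fun_prop)
  set K : ℝ := n * (κ + C * |(b * ρ * 1) ^ 2 - b ^ 2|) - b * ∑ i, τ i with hK
  -- Each of the `n` coordinates contributes `β g²/2`, so `g` is finally integrated against `exp(nβ
  -- g²/2)`, which turns its variance into `1/(1 - nβ)`.
  obtain ⟨σ, hσ, hσ1, hσ2⟩ := exists_sq_inv_eq_one_sub (show n * β < 1 by linarith)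
  have h2 : ∀ g : ℝ, ∫⁻ z, {z : Fin n → ℝ | ∀ i, τ i ≤ ρ * z i}.indicator 1 z *
        ENNReal.ofReal (Real.exp (√β * g * ∑ i, z i)) ∂(Measure.pi fun _ => gaussianReal 0 1)
      ≤ ENNReal.ofReal (Real.exp K) * ENNReal.ofReal
        (Real.exp ((n * (b * ρ * √β)) * g + (1 - (σ ^ 2)⁻¹) * g ^ 2 / 2)) := by
    intro g
    have := h.lintegral_halfLine_prod_le hb hρ one_pos τ (√β * g)
    simp only [one_pow, inv_one, sub_self, zero_mul, zero_div, add_zero, one_mul] at this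
    refine this.trans (le_of_eq ?_)
    rw [← ENNReal.ofReal_mul (Real.exp_pos _).le, ← Real.exp_add, hσ2, hK]
    congr 2
    rw [mul_pow, Real.sq_sqrt hβ]
    ring
  refine (lintegral_mono h2).trans ?_
  rw [lintegral_const_mul _ (by fun_prop), lintegral_exp_quadratic _ hσ,
    ← ENNReal.ofReal_mul (Real.exp_pos _).le]
  refine ENNReal.ofReal_le_ofReal ?_
  have hσle : σ ^ 2 ≤ 2 := by nlinarith [sq_nonneg σ]
  have hσe : σ ≤ Real.exp 1 := by
    have : (2 : ℝ) ≤ Real.exp 1 := by linarith [Real.add_one_le_exp (1 : ℝ)]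
    nlinarith
  have hnβ : 0 ≤ n * β := by positivity
  have hσ3 : σ ^ 2 ≤ 1 + 2 * (n * β) := by nlinarith
  set x := |ρ ^ 2 - 1| with hx
  have hx0 : 0 ≤ x := abs_nonneg _
  have hρx : ρ ^ 2 ≤ 1 + x := by linarith [le_abs_self (ρ ^ 2 - 1)]
  have habs : |(b * ρ * 1) ^ 2 - b ^ 2| = b ^ 2 * x := by
    rw [hx, show (b * ρ * 1) ^ 2 - b ^ 2 = b ^ 2 * (ρ ^ 2 - 1) by ring, abs_mul,
      abs_of_nonneg (sq_nonneg b)]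
  have hq : (n * (b * ρ * √β)) ^ 2 * σ ^ 2 / 2 ≤
      n ^ 2 * b ^ 2 * β / 2 + n ^ 3 * b ^ 2 * β ^ 2 + n * b ^ 2 * x := by
    have e1 : (n * (b * ρ * √β)) ^ 2 * σ ^ 2 / 2 = n ^ 2 * b ^ 2 * β / 2 * (ρ ^ 2 * σ ^ 2) := by
      rw [show (n * (b * ρ * √β)) ^ 2 = n ^ 2 * b ^ 2 * ρ ^ 2 * √β ^ 2 by ring, Real.sq_sqrt hβ]
      ring
    have e2 : ρ ^ 2 * σ ^ 2 ≤ (1 + 2 * (n * β)) + 2 * x := by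
      calc ρ ^ 2 * σ ^ 2 ≤ (1 + x) * σ ^ 2 := by gcongr
        _ = σ ^ 2 + x * σ ^ 2 := by ring
        _ ≤ (1 + 2 * (n * β)) + x * 2 := by gcongr
        _ = _ := by ring
    rw [e1]
    calc n ^ 2 * b ^ 2 * β / 2 * (ρ ^ 2 * σ ^ 2)
        ≤ n ^ 2 * b ^ 2 * β / 2 * ((1 + 2 * (n * β)) + 2 * x) := by gcongr
      _ = n ^ 2 * b ^ 2 * β / 2 + n ^ 3 * b ^ 2 * β ^ 2 + n * b ^ 2 * x * (n * β) := by ring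
      _ ≤ n ^ 2 * b ^ 2 * β / 2 + n ^ 3 * b ^ 2 * β ^ 2 + n * b ^ 2 * x * 1 := by
          gcongr; linarith
      _ = _ := by ring
  have hCx : 0 ≤ n * (C * b ^ 2) * x := by positivity
  have hCb : 0 ≤ C * b ^ 2 := by positivity
  calc Real.exp K * (σ * Real.exp ((n * (b * ρ * √β)) ^ 2 * σ ^ 2 / 2))
      ≤ Real.exp K * (Real.exp 1 * Real.exp (n ^ 2 * b ^ 2 * β / 2 + n ^ 3 * b ^ 2 * β ^ 2
        + n * b ^ 2 * x)) := by gcongr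
    _ = Real.exp (K + (1 + (n ^ 2 * b ^ 2 * β / 2 + n ^ 3 * b ^ 2 * β ^ 2
        + n * b ^ 2 * x))) := by
      rw [Real.exp_add K, Real.exp_add 1]
    _ ≤ _ := by
      refine Real.exp_le_exp.2 ?_
      rw [hK, habs]
      linarith

/-- With the negative sign, `β (S - nb)² ≥ 0` replaces `-β S²/2` by a linear function of `S`.
Expanding at `nb` loses little, since a Gaussian conditioned to exceed `a` has mean equal to the
hazard rate at `a`. The diagonal term `β z i²/2` stays and changes the variance to `1/(1 - β)`. -/
theorem HasTailBound.lintegral_column_le_of_neg {b κ C : ℝ} (h : HasTailBound b κ C) (hb : 0 < b)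
    (hC : 0 ≤ C) {ρ β : ℝ} (hρ : 0 ≤ ρ) (hβ : 0 ≤ β) (hβ2 : β ≤ 1 / 2) {n : ℕ}
    (hn : n * β ≤ 1 / 2) (τ : Fin n → ℝ) :
    ∫⁻ z, {z : Fin n → ℝ | ∀ i, τ i ≤ ρ * z i}.indicator 1 z *
        ENNReal.ofReal (Real.exp (-β * pairSum fun i j => z i * z j))
        ∂(Measure.pi fun _ => gaussianReal 0 1)
      ≤ ENNReal.ofReal (Real.exp (1 + C * b ^ 2 + n * κ - b * ∑ i, τ i - n ^ 2 * b ^ 2 * β / 2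
          + n ^ 3 * b ^ 2 * β ^ 2 + n * ((2 * C + 1) * b ^ 2) * |ρ ^ 2 - 1|)) := by
  have hind := measurable_indicator_halfSpaces τ ρ
  obtain ⟨σ, hσ, hσ1, hσ2⟩ := exists_sq_inv_eq_one_sub (show β < 1 by linarith)
  set v : ℝ := β * (n * b) with hv
  have h1 : ∀ z : Fin n → ℝ, {z : Fin n → ℝ | ∀ i, τ i ≤ ρ * z i}.indicator 1 z *
        ENNReal.ofReal (Real.exp (-β * pairSum fun i j => z i * z j))
      ≤ ENNReal.ofReal (Real.exp (β * (n * b) ^ 2 / 2)) *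
        ({z : Fin n → ℝ | ∀ i, τ i ≤ ρ * z i}.indicator 1 z * ENNReal.ofReal
        (Real.exp ((-v) * ∑ i, z i + (1 - (σ ^ 2)⁻¹) * (∑ i, z i ^ 2) / 2))) := by
    intro z
    rw [mul_left_comm, ← ENNReal.ofReal_mul (Real.exp_pos _).le, ← Real.exp_add]
    gcongr
    rw [pairSum_mul_self, hσ2, hv]
    nlinarith [mul_nonneg hβ (sq_nonneg (∑ i, z i - n * b))]
  refine (lintegral_mono h1).trans ?_
  rw [lintegral_const_mul' _ _ ENNReal.ofReal_ne_top]
  refine (mul_le_mul_right (h.lintegral_halfLine_prod_le hb hρ hσ τ (-v)) _).trans ?_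
  rw [← ENNReal.ofReal_mul (Real.exp_pos _).le]
  refine ENNReal.ofReal_le_ofReal ?_
  have hσle : σ ^ 2 ≤ 2 := by nlinarith [sq_nonneg σ]
  have hσ3 : σ ^ 2 ≤ 1 + 2 * β := by nlinarith
  have hσ4 : 1 ≤ σ ^ 2 := by nlinarith
  have hσe : σ ≤ Real.exp β := by
    have h1 : 1 + β ≤ Real.exp β := by linarith [Real.add_one_le_exp β]
    have h2 : σ ≤ 1 + β := by nlinarith
    exact h2.trans h1
  have hnβ : 0 ≤ n * β := by positivity
  have hσn : σ ^ n ≤ Real.exp (n * β) := by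
    rw [Real.exp_nat_mul]; gcongr
  set x := |ρ ^ 2 - 1| with hx
  have hx0 : 0 ≤ x := abs_nonneg _
  have hρx : 1 - x ≤ ρ := by
    rcases le_total ρ 1 with h | h
    · have := neg_abs_le (ρ ^ 2 - 1)
      nlinarith
    · linarith
  have habs : |(b * ρ * σ) ^ 2 - b ^ 2| ≤ b ^ 2 * (2 * x + 2 * β) := by
    rw [show (b * ρ * σ) ^ 2 - b ^ 2 = b ^ 2 * (σ ^ 2 * (ρ ^ 2 - 1) + (σ ^ 2 - 1)) by ring, abs_mul,
      abs_of_nonneg (sq_nonneg b)]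
    refine mul_le_mul_of_nonneg_left ((abs_add_le _ _).trans ?_) (sq_nonneg b)
    rw [abs_mul, abs_of_nonneg (sq_nonneg σ), abs_of_nonneg (show 0 ≤ σ ^ 2 - 1 by linarith), ← hx]
    nlinarith
  have e1 : n * (v ^ 2 * σ ^ 2 / 2) ≤ n ^ 3 * b ^ 2 * β ^ 2 := by
    calc n * (v ^ 2 * σ ^ 2 / 2) ≤ n * (v ^ 2 * 2 / 2) := by gcongr
      _ = _ := by rw [hv]; ring
  have e2 : n * (b * ρ * σ ^ 2 * v) ≥ n ^ 2 * b ^ 2 * β - n * b ^ 2 * x := by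
    have e3 : 1 - x ≤ ρ * σ ^ 2 := by nlinarith
    calc n * (b * ρ * σ ^ 2 * v) = n ^ 2 * b ^ 2 * β * (ρ * σ ^ 2) := by rw [hv]; ring
      _ ≥ n ^ 2 * b ^ 2 * β * (1 - x) := by gcongr
      _ = n ^ 2 * b ^ 2 * β - n * b ^ 2 * x * (n * β) := by ring
      _ ≥ n ^ 2 * b ^ 2 * β - n * b ^ 2 * x * 1 := by gcongr; linarith
      _ = _ := by ring
  have e4 : n * (C * |(b * ρ * σ) ^ 2 - b ^ 2|) ≤ n * (2 * C * b ^ 2) * x + C * b ^ 2 := by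
    calc n * (C * |(b * ρ * σ) ^ 2 - b ^ 2|) ≤ n * (C * (b ^ 2 * (2 * x + 2 * β))) := by gcongr
      _ = n * (2 * C * b ^ 2) * x + C * b ^ 2 * (2 * (n * β)) := by ring
      _ ≤ n * (2 * C * b ^ 2) * x + C * b ^ 2 * 1 := by gcongr; linarith
      _ = _ := by ring
  calc _ ≤ Real.exp (β * (n * b) ^ 2 / 2) * (Real.exp (n * β) * Real.exp (n * ((-v) ^ 2 * σ ^ 2 / 2
          + κ + C * |(b * ρ * σ) ^ 2 - b ^ 2| + b * ρ * σ ^ 2 * (-v)) - b * ∑ i, τ i)) := by gcongr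
    _ = Real.exp (β * (n * b) ^ 2 / 2 + (n * β + (n * ((-v) ^ 2 * σ ^ 2 / 2
          + κ + C * |(b * ρ * σ) ^ 2 - b ^ 2| + b * ρ * σ ^ 2 * (-v)) - b * ∑ i, τ i))) := by
      rw [Real.exp_add (β * (n * b) ^ 2 / 2), Real.exp_add (n * β)]
    _ ≤ _ := by
      refine Real.exp_le_exp.2 ?_
      rw [neg_sq]
      have : β * (n * b) ^ 2 / 2 = n ^ 2 * b ^ 2 * β / 2 := by ring
      linarith

/-! ### Norms and rotations of Gaussian vectors -/

/-- The standard Gaussian measure on `ℝ^d`. -/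
noncomputable abbrev gaussianVec (d : ℕ) : Measure (Fin d → ℝ) :=
  Measure.pi fun _ => gaussianReal 0 1

theorem lintegral_gaussianVec_exp_sq {d : ℕ} {x : ℝ} (hx : |x| ≤ 1 / 2) :
    ∫⁻ y, ENNReal.ofReal (Real.exp (x * (y ⬝ᵥ y) / 2)) ∂(gaussianVec d)
      ≤ ENNReal.ofReal (Real.exp (d * (x + 2 * x ^ 2) / 2)) := by
  have hx1 := (abs_le.1 hx).1
  have hx2 := (abs_le.1 hx).2
  obtain ⟨σ, hσ, hσ1, hσ2⟩ := exists_sq_inv_eq_one_sub (show x < 1 by linarith)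
  have e : ∀ y : Fin d → ℝ, ENNReal.ofReal (Real.exp (x * (y ⬝ᵥ y) / 2))
      = ∏ i, ENNReal.ofReal (Real.exp (0 * y i + (1 - (σ ^ 2)⁻¹) * y i ^ 2 / 2)) := by
    intro y
    rw [← ENNReal.ofReal_prod_of_nonneg (fun i _ => (Real.exp_pos _).le), ← Real.exp_sum, hσ2]
    simp only [dotProduct, zero_mul, zero_add, ← Finset.sum_div, ← Finset.mul_sum, pow_two]
  simp_rw [e]
  rw [lintegral_pi_prod_eq (gaussianReal 0 1) (f := fun _ z =>
    ENNReal.ofReal (Real.exp (0 * z + (1 - (σ ^ 2)⁻¹) * z ^ 2 / 2))) (fun i => by fun_prop)]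
  simp_rw [lintegral_exp_quadratic 0 hσ]
  simp only [ne_eq, OfNat.ofNat_ne_zero, not_false_eq_true, zero_pow, zero_mul, zero_div,
    Real.exp_zero, mul_one, Finset.prod_const, Finset.card_univ, Fintype.card_fin]
  rw [← ENNReal.ofReal_pow hσ.le]
  refine ENNReal.ofReal_le_ofReal ?_
  have h1 : σ ^ 2 ≤ Real.exp (x + 2 * x ^ 2) := by
    have h2 := Real.add_one_le_exp (x + 2 * x ^ 2)
    have h3 : 1 ≤ (1 - x) * Real.exp (x + 2 * x ^ 2) := by
      have : (1 - x) * (x + 2 * x ^ 2 + 1) ≤ (1 - x) * Real.exp (x + 2 * x ^ 2) :=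
        mul_le_mul_of_nonneg_left h2 (by linarith)
      nlinarith [mul_nonneg (sq_nonneg x) (show 0 ≤ 1 - 2 * x by linarith)]
    calc σ ^ 2 ≤ σ ^ 2 * ((1 - x) * Real.exp (x + 2 * x ^ 2)) :=
          le_mul_of_one_le_right (sq_nonneg σ) h3
      _ = (σ ^ 2 * (1 - x)) * Real.exp (x + 2 * x ^ 2) := by ring
      _ = _ := by rw [hσ1, one_mul]
  have h2 : σ ≤ Real.exp ((x + 2 * x ^ 2) / 2) := by
    rw [← abs_of_pos hσ, ← abs_of_pos (Real.exp_pos _), ← sq_le_sq, ← Real.exp_nat_mul]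
    refine h1.trans (le_of_eq ?_)
    congr 1
    push_cast; ring
  calc σ ^ d ≤ Real.exp ((x + 2 * x ^ 2) / 2) ^ d := by gcongr
    _ = _ := by rw [← Real.exp_nat_mul, mul_div_assoc]

/-- Controls the fluctuation of a vector's squared norm by a constant independent of `k`. After
`exp(A|u|) ≤ exp(Au) + exp(-Au)` both integrals are explicit; `m ≥ k²` bounds the second-order term
by `4c²`, and the at most `k` missing dimensions cost at most `c`. -/
theorem lintegral_gaussianVec_exp_abs_le {m d k : ℕ} {A c : ℝ} (hA : 0 ≤ A) (hc0 : 0 ≤ c) (hAk : A ≤ k * c)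
    (hd : d ≤ m) (hm : m ≤ d + k) (hkm : k ^ 2 ≤ m) (hm0 : 0 < m) (hc : 4 * c * k ≤ m) :
    ∫⁻ y, ENNReal.ofReal (Real.exp (A * |(y ⬝ᵥ y) / m - 1|)) ∂(gaussianVec d)
      ≤ ENNReal.ofReal (Real.exp (1 + c + 4 * c ^ 2)) := by
  have hM : (0 : ℝ) < m := by exact_mod_cast hm0
  have hd' : (d : ℝ) ≤ m := by exact_mod_cast hd
  have hm' : (m : ℝ) ≤ d + k := by exact_mod_cast hm
  have hkm' : (k : ℝ) ^ 2 ≤ m := by exact_mod_cast hkm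
  set x : ℝ := 2 * A / m with hx
  have hx0 : 0 ≤ x := by positivity
  have hxm : x * m = 2 * A := by rw [hx]; field_simp
  have hx1 : x ≤ 1 / 2 := by
    rw [hx, div_le_iff₀ hM]; linarith
  have hxa : |x| ≤ 1 / 2 := by rwa [abs_of_nonneg hx0]
  have hxb : |-x| ≤ 1 / 2 := by rwa [abs_neg]
  have hk0 : (0 : ℝ) ≤ k := by positivity
  have hmx : (m : ℝ) * x ^ 2 ≤ 4 * c ^ 2 := by
    have h1 : (m : ℝ) * x ^ 2 = 4 * A ^ 2 / m := by rw [hx]; field_simp; ring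
    rw [h1, div_le_iff₀ hM]
    have : A ^ 2 ≤ (k * c) ^ 2 := by gcongr
    nlinarith [mul_le_mul_of_nonneg_left hkm' (sq_nonneg c)]
  have hdx : (d : ℝ) * x ^ 2 ≤ 4 * c ^ 2 := le_trans (by gcongr) hmx
  have hAx : A * ((m : ℝ) - d) / m ≤ c := by
    rw [div_le_iff₀ hM]
    calc A * ((m : ℝ) - d) ≤ (k * c) * k := by gcongr; linarith
      _ = c * k ^ 2 := by ring
      _ ≤ c * m := by gcongr
  have h1 : ∀ y : Fin d → ℝ, ENNReal.ofReal (Real.exp (A * |(y ⬝ᵥ y) / m - 1|)) ≤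
      ENNReal.ofReal (Real.exp (-A)) * ENNReal.ofReal (Real.exp (x * (y ⬝ᵥ y) / 2))
      + ENNReal.ofReal (Real.exp A) * ENNReal.ofReal (Real.exp ((-x) * (y ⬝ᵥ y) / 2)) := by
    intro y
    rw [← ENNReal.ofReal_mul (Real.exp_pos _).le, ← ENNReal.ofReal_mul (Real.exp_pos _).le,
      ← Real.exp_add, ← Real.exp_add,
      ← ENNReal.ofReal_add (Real.exp_pos _).le (Real.exp_pos _).le]
    refine ENNReal.ofReal_le_ofReal ?_
    have e1 : -A + x * (y ⬝ᵥ y) / 2 = A * ((y ⬝ᵥ y) / m - 1) := by rw [hx]; field_simp; ring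
    have e2 : A + -x * (y ⬝ᵥ y) / 2 = A * -((y ⬝ᵥ y) / m - 1) := by rw [hx]; field_simp; ring
    rw [e1, e2]
    rcases abs_choice ((y ⬝ᵥ y) / m - 1) with h | h <;> rw [h]
    · linarith [Real.exp_pos (A * -((y ⬝ᵥ y) / m - 1))]
    · linarith [Real.exp_pos (A * ((y ⬝ᵥ y) / m - 1))]
  have hmeas : ∀ t : ℝ, Measurable fun y : Fin d → ℝ =>
      ENNReal.ofReal (Real.exp (t * (y ⬝ᵥ y) / 2)) := fun t => by
    unfold dotProduct; fun_prop
  refine (lintegral_mono h1).trans ?_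
  rw [lintegral_add_left ((hmeas x).const_mul _), lintegral_const_mul _ (hmeas _),
    lintegral_const_mul _ (hmeas _)]
  refine (add_le_add (mul_le_mul_right (lintegral_gaussianVec_exp_sq hxa) _)
    (mul_le_mul_right (lintegral_gaussianVec_exp_sq hxb) _)).trans ?_
  rw [← ENNReal.ofReal_mul (Real.exp_pos _).le, ← ENNReal.ofReal_mul (Real.exp_pos _).le,
      ← Real.exp_add, ← Real.exp_add,
      ← ENNReal.ofReal_add (Real.exp_pos _).le (Real.exp_pos _).le]
  refine ENNReal.ofReal_le_ofReal ?_
  have b1 : Real.exp (-A + d * (x + 2 * x ^ 2) / 2) ≤ Real.exp (c + 4 * c ^ 2) := by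
    refine Real.exp_le_exp.2 ?_
    have : d * x ≤ m * x := by gcongr
    linarith
  have b2 : Real.exp (A + d * (-x + 2 * (-x) ^ 2) / 2) ≤ Real.exp (c + 4 * c ^ 2) := by
    refine Real.exp_le_exp.2 ?_
    have e1 : A * ((m : ℝ) - d) / m = A - d * x / 2 := by rw [hx]; field_simp
    rw [neg_sq]
    linarith
  have b3 : Real.exp (1 + c + 4 * c ^ 2) = Real.exp 1 * Real.exp (c + 4 * c ^ 2) := by
    rw [← Real.exp_add, add_assoc]
  have b4 : (2 : ℝ) ≤ Real.exp 1 := by linarith [Real.add_one_le_exp (1 : ℝ)]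
  rw [b3]
  nlinarith [Real.exp_pos (c + 4 * c ^ 2)]

/-- The map is the reflection exchanging `x` with `ς‖x‖` times the first basis vector. Including `ς`
makes `ς` times the inner product with `x` equal to `‖x‖ y 0`, so both colours lead to lower bounds
on first coordinates. -/
theorem exists_measurePreserving_rotation {d : ℕ} (x : Fin (d + 1) → ℝ) {ς : ℝ} (hς : |ς| = 1) :
    ∃ R : (Fin (d + 1) → ℝ) → (Fin (d + 1) → ℝ),
      MeasurePreserving R (gaussianVec (d + 1)) (gaussianVec (d + 1)) ∧
      (∀ y w, R y ⬝ᵥ R w = y ⬝ᵥ w) ∧ ∀ y, x ⬝ᵥ R y = ς * √(x ⬝ᵥ x) * y 0 := by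
  let E := EuclideanSpace ℝ (Fin (d + 1))
  have hin : ∀ y w : Fin (d + 1) → ℝ, inner ℝ (WithLp.toLp 2 y : E) (WithLp.toLp 2 w) = y ⬝ᵥ w := by
    intro y w
    rw [EuclideanSpace.inner_eq_star_dotProduct]
    simp [dotProduct_comm]
  let v : E := WithLp.toLp 2 x
  have hv : ‖v‖ = √(x ⬝ᵥ x) := by rw [← hin, norm_eq_sqrt_real_inner]
  have hs : ‖(EuclideanSpace.single 0 1 : EuclideanSpace ℝ (Fin (d + 1)))‖ = 1 := by simp
  have hi : ∀ y : Fin (d + 1) → ℝ, inner ℝ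
      (EuclideanSpace.single 0 1 : EuclideanSpace ℝ (Fin (d + 1))) (WithLp.toLp 2 y) = y 0 := by
    simp [EuclideanSpace.inner_single_left]
  let w : E := (ς * ‖v‖) • EuclideanSpace.single 0 1
  have hw : ‖v‖ = ‖w‖ := by
    simp only [w]
    rw [norm_smul, hs, mul_one, Real.norm_eq_abs, abs_mul, hς, one_mul, abs_norm]
  let L : E ≃ₗᵢ[ℝ] E := Submodule.reflection (Submodule.span ℝ {v - w})ᗮ
  have hL : L v = w := Submodule.reflection_sub hw
  have hLL : ∀ y, L (L y) = y := fun y => Submodule.reflection_reflection _ y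
  have hmp1 : MeasurePreserving (WithLp.toLp 2 : (Fin (d + 1) → ℝ) → E) (gaussianVec (d + 1))
      (stdGaussian E) := ⟨by fun_prop, map_pi_eq_stdGaussian⟩
  have hmp2 : MeasurePreserving L (stdGaussian E) (stdGaussian E) :=
    ⟨L.continuous.measurable, stdGaussian_map L⟩
  have hmp3 : MeasurePreserving (WithLp.ofLp : E → (Fin (d + 1) → ℝ)) (stdGaussian E)
      (gaussianVec (d + 1)) := by
    refine ⟨by fun_prop, ?_⟩
    rw [← hmp1.map_eq, Measure.map_map (by fun_prop) (by fun_prop)]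
    exact Measure.map_id
  refine ⟨fun y => WithLp.ofLp (L (WithLp.toLp 2 y)), hmp3.comp (hmp2.comp hmp1), ?_, ?_⟩
  · intro y w
    rw [← hin, ← hin]
    exact L.inner_map_map _ _
  · intro y
    rw [← hin, ← hv]
    change inner ℝ v (L (WithLp.toLp 2 y)) = _
    rw [← L.inner_map_map, hLL, hL]
    simp only [w]
    rw [inner_smul_left, hi]
    rfl

/-! ### Clique probabilities by exposing one vector at a time -/

theorem measurePreserving_consColumns (n d : ℕ) :
    MeasurePreserving (fun p : (Fin n → ℝ) × (Fin n → Fin d → ℝ) =>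
        fun i => (Fin.cons (p.1 i) (p.2 i) : Fin (d + 1) → ℝ))
      ((Measure.pi fun _ => gaussianReal 0 1).prod (Measure.pi fun _ => gaussianVec d))
      (Measure.pi fun _ => gaussianVec (d + 1)) := by
  have h1 := (measurePreserving_arrowProdEquivProdArrow ℝ (Fin d → ℝ) (Fin n)
    (fun _ => gaussianReal 0 1) (fun _ => gaussianVec d)).symm
  have h2 := measurePreserving_pi (fun _ : Fin n => (gaussianReal 0 1).prod (gaussianVec d))
    (fun _ => gaussianVec (d + 1)) (fun _ => measurePreserving_finCons (gaussianReal 0 1) d)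
  exact h2.comp h1

/-- The additive constant per vertex in the bound for clique probabilities. -/
noncomputable def cliqueConst (b C : ℝ) : ℝ :=
  2 + C * b ^ 2 + (2 * C + 1) * b ^ 2 + 4 * ((2 * C + 1) * b ^ 2) ^ 2

/-- Bound for the probability that the inner products of independent Gaussian vectors all
exceed prescribed values. -/
theorem HasTailBound.measure_inner_ge_le {b κ C : ℝ} (h : HasTailBound b κ C) (hb : 0 < b)
    (hC : 0 ≤ C) {ς : ℝ} (hς : ς = 1 ∨ ς = -1) {k m : ℕ} (hk : 1 ≤ k) (hkm : k ^ 2 ≤ m)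
    (hbk : 2 * b * k ≤ √m) (hc : 4 * ((2 * C + 1) * b ^ 2) * k ≤ m) (n : ℕ) :
    ∀ d : ℕ, n ≤ k → d ≤ m → m + n ≤ d + k → ∀ T : Fin n → Fin n → ℝ,
    (Measure.pi fun _ : Fin n => gaussianVec d)
      {x | ∀ i j, i < j → T i j ≤ ς * (x i ⬝ᵥ x j) / √m}
    ≤ ENNReal.ofReal (Real.exp (n * cliqueConst b C + ∑ q ∈ Finset.range n,
        (q * κ + ς * (q ^ 2 * b ^ 3 / (2 * √m)) + q ^ 3 * b ^ 4 / m) - b * pairSum T)) := by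
  have hk' : (1 : ℝ) ≤ k := by exact_mod_cast hk
  have hM0 : 0 < m := lt_of_lt_of_le (by positivity) hkm
  have hM : (0 : ℝ) < m := by exact_mod_cast hM0
  have hsq : (√m : ℝ) ^ 2 = m := Real.sq_sqrt hM.le
  have hs0 : 0 < √(m : ℝ) := Real.sqrt_pos.2 hM
  have hς2 : ς * ς = 1 := by rcases hς with rfl | rfl <;> norm_num
  have hςa : |ς| = 1 := by rcases hς with rfl | rfl <;> norm_num
  set β : ℝ := b / √m with hβ
  have hβ0 : 0 ≤ β := by positivity
  have hkβ : k * β ≤ 1 / 2 := by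
    rw [hβ, ← mul_div_assoc, div_le_iff₀ hs0]; linarith
  have hβ2 : β ≤ 1 / 2 := le_trans (by nlinarith) hkβ
  -- The normalisation `√m` stays fixed while every exposed vector uses up one dimension; `m + n ≤ d
  -- + k` bounds the number used. The thresholds `T` must be arbitrary because conditioning shifts
  -- them.
  induction n with
  | zero =>
    intro d _ _ _ T
    simp [pairSum]
  | succ n ih =>
    intro d hn hd hm T
    obtain ⟨d, rfl⟩ : ∃ d', d = d' + 1 := by
      refine ⟨d - 1, ?_⟩
      have : k ≤ k ^ 2 := Nat.le_self_pow two_ne_zero k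
      omega
    have hnβ : n * β ≤ 1 / 2 := by
      have : (n : ℝ) ≤ k := by exact_mod_cast (by omega : n ≤ k)
      exact le_trans (by gcongr) hkβ
    set S : Set (Fin (n + 1) → Fin (d + 1) → ℝ) :=
      {x | ∀ i j, i < j → T i j ≤ ς * (x i ⬝ᵥ x j) / √m} with hS
    have hSm : ∀ (n d : ℕ) (T : Fin n → Fin n → ℝ), MeasurableSet
        {x : Fin n → Fin d → ℝ | ∀ i j, i < j → T i j ≤ ς * (x i ⬝ᵥ x j) / √m} := by
      intro n d T
      simp only [ofPred_forall]
      refine MeasurableSet.iInter fun i => MeasurableSet.iInter fun j => MeasurableSet.iInter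
        fun _ => measurableSet_le measurable_const ?_
      unfold dotProduct
      fun_prop
    have hSS : MeasurableSet S := hSm _ _ T
    set E : ℝ := 1 + C * b ^ 2 + n * κ - b * ∑ i, T 0 (Fin.succ i)
      + ς * (n ^ 2 * b ^ 2 * β / 2) + n ^ 3 * b ^ 2 * β ^ 2
      + (n * cliqueConst b C + ∑ q ∈ Finset.range n,
        (q * κ + ς * (q ^ 2 * b ^ 3 / (2 * √m)) + q ^ 3 * b ^ 4 / m)
        - b * pairSum fun i j => T i.succ j.succ) with hE
    set A : ℝ := n * ((2 * C + 1) * b ^ 2) with hA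
    have hcond : ∀ x₀ : Fin (d + 1) → ℝ,
        ∫⁻ y, S.indicator 1 (Fin.cons x₀ y) ∂(Measure.pi fun _ : Fin n => gaussianVec (d + 1))
        ≤ ENNReal.ofReal (Real.exp E)
          * ENNReal.ofReal (Real.exp (A * |(x₀ ⬝ᵥ x₀) / m - 1|)) := by
      intro x₀
      -- Applying `R` to all other vectors preserves their law and their mutual inner products,
      -- while the constraints involving `x₀` become `T 0 i.succ ≤ ρ * z i` on first coordinates,
      -- with `ρ = ‖x₀‖/√m`.
      obtain ⟨R, hR, hR1, hR2⟩ := exists_measurePreserving_rotation x₀ hςa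
      have hRn := measurePreserving_pi (fun _ : Fin n => gaussianVec (d + 1))
        (fun _ => gaussianVec (d + 1)) (fun _ => hR)
      have hcons : Measurable fun y : Fin n → Fin (d + 1) → ℝ =>
          (Fin.cons x₀ y : Fin (n + 1) → Fin (d + 1) → ℝ) :=
        (measurePreserving_finCons (gaussianVec (d + 1)) n).measurable.comp
          measurable_prodMk_left
      have hf : Measurable fun y : Fin n → Fin (d + 1) → ℝ =>
          S.indicator (1 : (Fin (n + 1) → Fin (d + 1) → ℝ) → ℝ≥0∞) (Fin.cons x₀ y) :=
        (measurable_one.indicator hSS).comp hcons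
      have hcol := measurePreserving_consColumns n d
      have hf2 : Measurable fun y : Fin n → Fin (d + 1) → ℝ =>
          S.indicator (1 : (Fin (n + 1) → Fin (d + 1) → ℝ) → ℝ≥0∞)
            (Fin.cons x₀ fun i => R (y i)) := hf.comp hRn.measurable
      have hf3 : Measurable fun p : (Fin n → ℝ) × (Fin n → Fin d → ℝ) =>
          S.indicator (1 : (Fin (n + 1) → Fin (d + 1) → ℝ) → ℝ≥0∞)
            (Fin.cons x₀ fun i => R (Fin.cons (p.1 i) (p.2 i))) := hf2.comp hcol.measurable
      rw [← hRn.lintegral_comp hf, ← hcol.lintegral_comp hf2, lintegral_prod _ hf3.aemeasurable]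
      set ρ : ℝ := √(x₀ ⬝ᵥ x₀) / √m with hρ
      have hρ0 : 0 ≤ ρ := by positivity
      have hxx : 0 ≤ x₀ ⬝ᵥ x₀ := by
        rw [dotProduct]; exact Finset.sum_nonneg fun i _ => mul_self_nonneg _
      have hρ2 : ρ ^ 2 = (x₀ ⬝ᵥ x₀) / m := by
        rw [hρ, div_pow, hsq, Real.sq_sqrt hxx]
      set I : (Fin n → ℝ) → ℝ≥0∞ :=
        {z : Fin n → ℝ | ∀ i, T 0 (Fin.succ i) ≤ ρ * z i}.indicator 1 with hI
      set F : ℝ := n * cliqueConst b C + ∑ q ∈ Finset.range n,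
        (q * κ + ς * (q ^ 2 * b ^ 3 / (2 * √m)) + q ^ 3 * b ^ 4 / m)
        - b * pairSum fun i j => T i.succ j.succ with hF
      have hinner : ∀ z : Fin n → ℝ,
          ∫⁻ w, S.indicator 1 (Fin.cons x₀ fun i => R (Fin.cons (z i) (w i)))
            ∂(Measure.pi fun _ : Fin n => gaussianVec d)
          ≤ ENNReal.ofReal (Real.exp F) *
            (I z * ENNReal.ofReal (Real.exp (ς * β * pairSum fun i j => z i * z j))) := by
        intro z
        -- The product `z i * z j` of first coordinates is moved into the threshold. As the
        -- inductive bound depends on `T` through `exp(-b * pairSum T)`, this yields the weight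
        -- `exp(ςβ * pairSum (z i * z j))` with `β = b/√m`.
        set T' : Fin n → Fin n → ℝ := fun i j =>
          T i.succ j.succ - ς / √m * (z i * z j) with hT'
        have hle : ∀ w : Fin n → Fin d → ℝ,
            S.indicator 1 (Fin.cons x₀ fun i => R (Fin.cons (z i) (w i)))
            ≤ I z * {x : Fin n → Fin d → ℝ | ∀ i j, i < j →
              T' i j ≤ ς * (x i ⬝ᵥ x j) / √m}.indicator (1 : (Fin n → Fin d → ℝ) → ℝ≥0∞) w := by
          intro w
          by_cases hw : (Fin.cons x₀ fun i => R (Fin.cons (z i) (w i))) ∈ S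
          · have h1 : ∀ i, T 0 (Fin.succ i) ≤ ρ * z i := by
              intro i
              have := hw 0 i.succ (Fin.succ_pos i)
              rw [Fin.cons_zero, Fin.cons_succ, hR2, Fin.cons_zero] at this
              refine this.trans (le_of_eq ?_)
              rw [hρ, mul_assoc, ← mul_assoc, hς2]
              ring
            have h2 : ∀ i j, i < j → T' i j ≤ ς * (w i ⬝ᵥ w j) / √m := by
              intro i j hij
              have := hw i.succ j.succ (Fin.succ_lt_succ_iff.2 hij)
              rw [Fin.cons_succ, Fin.cons_succ, hR1] at this
              have e : (Fin.cons (z i) (w i) : Fin (d + 1) → ℝ) ⬝ᵥ Fin.cons (z j) (w j)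
                  = z i * z j + w i ⬝ᵥ w j := by
                simp [dotProduct, Fin.sum_univ_succ]
              rw [e] at this
              rw [hT', sub_le_iff_le_add]
              refine this.trans (le_of_eq ?_)
              ring
            rw [hI, indicator_of_mem hw, indicator_of_mem (by exact h1),
              indicator_of_mem (by exact h2)]
            simp
          · rw [indicator_of_notMem hw]
            exact zero_le
        refine (lintegral_mono hle).trans ?_
        rw [lintegral_const_mul _ (measurable_one.indicator (hSm _ _ T')),
          lintegral_indicator_one (hSm _ _ T'), mul_left_comm,
          ← ENNReal.ofReal_mul (Real.exp_pos _).le, ← Real.exp_add]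
        refine mul_le_mul_right ((ih d (by omega) (by omega) (by omega) T').trans (le_of_eq ?_)) _
        rw [hT', pairSum_sub_mul, hF, hβ]
        congr 2
        ring
      refine (lintegral_mono hinner).trans ?_
      rw [lintegral_const_mul' _ _ ENNReal.ofReal_ne_top]
      have hcolumn : ∫⁻ z, I z * ENNReal.ofReal (Real.exp (ς * β * pairSum fun i j => z i * z j))
          ∂(Measure.pi fun _ => gaussianReal 0 1)
          ≤ ENNReal.ofReal (Real.exp (1 + C * b ^ 2 + n * κ - b * ∑ i, T 0 (Fin.succ i)
            + ς * (n ^ 2 * b ^ 2 * β / 2)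
            + n ^ 3 * b ^ 2 * β ^ 2 + n * ((2 * C + 1) * b ^ 2) * |ρ ^ 2 - 1|)) := by
        rcases hς with rfl | rfl
        · have := h.lintegral_column_le_of_pos hb hC hρ0 hβ0 hnβ fun i => T 0 (Fin.succ i)
          simpa only [one_mul] using this
        · have := h.lintegral_column_le_of_neg hb hC hρ0 hβ0 hβ2 hnβ fun i => T 0 (Fin.succ i)
          simpa only [neg_mul, one_mul, ← sub_eq_add_neg] using this
      refine (mul_le_mul_right hcolumn _).trans (le_of_eq ?_)
      rw [← ENNReal.ofReal_mul (Real.exp_pos _).le, ← ENNReal.ofReal_mul (Real.exp_pos _).le,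
        ← Real.exp_add, ← Real.exp_add, hρ2, hE, hF, hA]
      congr 2
      ring
    rw [← lintegral_indicator_one hSS, lintegral_pi_finCons _ (measurable_one.indicator hSS)]
    refine (lintegral_mono hcond).trans ?_
    rw [lintegral_const_mul' _ _ ENNReal.ofReal_ne_top]
    have hc0 : 0 ≤ (2 * C + 1) * b ^ 2 := by positivity
    have hnk : (n : ℝ) ≤ k := by exact_mod_cast (by omega : n ≤ k)
    refine (mul_le_mul_right (lintegral_gaussianVec_exp_abs_le (k := k)
      (c := (2 * C + 1) * b ^ 2) (by positivity) hc0 (by rw [hA]; gcongr) hd (by omega) hkm hM0 hc)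
      _).trans (le_of_eq ?_)
    rw [← ENNReal.ofReal_mul (Real.exp_pos _).le, ← Real.exp_add, hE, Finset.sum_range_succ,
      pairSum_succ, hβ]
    congr 2
    rw [div_pow, hsq]
    push_cast
    have e : (n : ℝ) ^ 2 * b ^ 2 * (b / √m) / 2 = n ^ 2 * b ^ 3 / (2 * √m) := by
      field_simp
    rw [e, cliqueConst]
    ring

/-! ### From clique probabilities to Ramsey numbers -/

theorem measurePreserving_pi_comp_injective {X : Type} [MeasurableSpace X] (μ : Measure X)
    [IsProbabilityMeasure μ] {n N : ℕ} {e : Fin n → Fin N} (he : Function.Injective e) :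
    MeasurePreserving (fun (x : Fin N → X) i => x (e i)) (Measure.pi fun _ => μ)
      (Measure.pi fun _ => μ) := by
  refine ⟨by fun_prop, ?_⟩
  have h1 : iIndepFun (fun (i : Fin N) (x : Fin N → X) => x i) (Measure.pi fun _ => μ) :=
    iIndepFun_pi (X := fun _ x => x) (fun _ => aemeasurable_id)
  have h2 := h1.precomp he
  rw [iIndepFun_iff_map_fun_eq_pi_map (fun i => (measurable_pi_apply (e i)).aemeasurable)] at h2
  refine h2.trans ?_
  congr 1
  funext i
  exact (measurePreserving_eval (fun _ : Fin N => μ) (e i)).map_eq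

/-- The graph joining two vertices if their vectors have a very negative inner product. -/
noncomputable def innerGraph {N d : ℕ} (a c : ℝ) (x : Fin N → Fin d → ℝ) :
    SimpleGraph (Fin N) where
  Adj i j := i ≠ j ∧ a ≤ -1 * (x i ⬝ᵥ x j) / c
  symm := ⟨fun i j h => ⟨h.1.symm, by rw [dotProduct_comm]; exact h.2⟩⟩
  loopless := ⟨fun i h => h.1 rfl⟩

theorem measure_exists_isNClique_le {N d n : ℕ} (G : (Fin N → Fin d → ℝ) → SimpleGraph (Fin N))
    (a c ς : ℝ) (hG : ∀ x i j, (G x).Adj i j → a ≤ ς * (x i ⬝ᵥ x j) / c) :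
    (Measure.pi fun _ : Fin N => gaussianVec d) {x | ∃ s : Finset (Fin N), (G x).IsNClique n s}
      ≤ N.choose n * (Measure.pi fun _ : Fin n => gaussianVec d)
        {x | ∀ i j, i < j → a ≤ ς * (x i ⬝ᵥ x j) / c} := by
  set S : Set (Fin n → Fin d → ℝ) := {x | ∀ i j, i < j → a ≤ ς * (x i ⬝ᵥ x j) / c} with hS
  have hSm : MeasurableSet S := by
    rw [hS]
    simp only [ofPred_forall]
    refine MeasurableSet.iInter fun i => MeasurableSet.iInter fun j => MeasurableSet.iInter
      fun _ => measurableSet_le measurable_const ?_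
    unfold dotProduct
    fun_prop
  have hsub : {x | ∃ s : Finset (Fin N), (G x).IsNClique n s}
      ⊆ ⋃ s ∈ (Finset.univ : Finset (Fin N)).powersetCard n, {x | (G x).IsNClique n s} := by
    rintro x ⟨s, hs⟩
    simp only [mem_iUnion]
    exact ⟨s, by simpa using hs.card_eq, hs⟩
  refine (measure_mono hsub).trans ((measure_biUnion_finset_le _ _).trans ?_)
  have hone : ∀ s ∈ (Finset.univ : Finset (Fin N)).powersetCard n,
      (Measure.pi fun _ : Fin N => gaussianVec d) {x | (G x).IsNClique n s}
      ≤ (Measure.pi fun _ : Fin n => gaussianVec d) S := by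
    intro s hs
    have hcard : s.card = n := (Finset.mem_powersetCard.1 hs).2
    set e := s.orderEmbOfFin hcard
    have hmp := measurePreserving_pi_comp_injective (gaussianVec d) e.injective
    rw [← hmp.measure_preimage hSm.nullMeasurableSet]
    refine measure_mono fun x hx i j hij => hG x _ _ ?_
    exact hx.isClique (s.orderEmbOfFin_mem hcard i) (s.orderEmbOfFin_mem hcard j)
      (fun h => hij.ne (e.injective h))
  refine (Finset.sum_le_sum hone).trans (le_of_eq ?_)
  simp

theorem exists_graph_of_measure_lt_one {N d l k : ℕ} (a c : ℝ)
    (h : N.choose l * (Measure.pi fun _ : Fin l => gaussianVec d)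
        {x | ∀ i j, i < j → a ≤ -1 * (x i ⬝ᵥ x j) / c}
      + N.choose k * (Measure.pi fun _ : Fin k => gaussianVec d)
        {x | ∀ i j, i < j → -a ≤ 1 * (x i ⬝ᵥ x j) / c} < 1) :
    ∃ R : SimpleGraph (Fin N), (¬ ∃ s : Finset (Fin N), R.IsNClique l s) ∧
      ¬ ∃ s : Finset (Fin N), Rᶜ.IsNClique k s := by
  by_contra! hcon
  have h1 := measure_exists_isNClique_le (n := l) (fun x : Fin N → Fin d → ℝ => innerGraph a c x)
    a c (-1) (fun x i j hij => hij.2)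
  have h2 := measure_exists_isNClique_le (n := k) (fun x : Fin N → Fin d → ℝ => (innerGraph a c x)ᶜ)
    (-a) c 1 (fun x i j hij => by
      rw [SimpleGraph.compl_adj] at hij
      have : ¬ a ≤ -1 * (x i ⬝ᵥ x j) / c := fun h => hij.2 ⟨hij.1, h⟩
      have e : -1 * (x i ⬝ᵥ x j) / c = -(1 * (x i ⬝ᵥ x j) / c) := by ring
      rw [e] at this
      linarith)
  have huniv : (univ : Set (Fin N → Fin d → ℝ)) ⊆
      {x | ∃ s : Finset (Fin N), (innerGraph a c x).IsNClique l s} ∪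
      {x | ∃ s : Finset (Fin N), (innerGraph a c x)ᶜ.IsNClique k s} := by
    intro x _
    by_cases hx : ∃ s : Finset (Fin N), (innerGraph a c x).IsNClique l s
    · exact Or.inl hx
    · exact Or.inr (hcon _ fun s hs => hx ⟨s, hs⟩)
  have := (measure_mono (μ := Measure.pi fun _ : Fin N => gaussianVec d) huniv).trans
    (measure_union_le _ _)
  rw [measure_univ] at this
  exact absurd (this.trans (add_le_add h1 h2)) (not_le.2 h)

/-- The finite Ramsey theorem for two colours. -/
theorem exists_ramsey_bound (l k : ℕ) : ∃ n : ℕ, ∀ (V : Type) [DecidableEq V] (R : SimpleGraph V)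
    (W : Finset V), n ≤ W.card → (∃ s ⊆ W, R.IsNClique l s) ∨ (∃ s ⊆ W, Rᶜ.IsNClique k s) := by
  induction l generalizing k with
  | zero => exact ⟨0, fun V _ R W _ => Or.inl ⟨∅, by simp, by simp⟩⟩
  | succ l ihl =>
    induction k with
    | zero => exact ⟨0, fun V _ R W _ => Or.inr ⟨∅, by simp, by simp⟩⟩
    | succ k ihk =>
      obtain ⟨n₁, h₁⟩ := ihl (k + 1)
      obtain ⟨n₂, h₂⟩ := ihk
      refine ⟨n₁ + n₂ + 1, fun V _ R W hW => ?_⟩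
      obtain ⟨v, hv⟩ : W.Nonempty := Finset.card_pos.1 (by omega)
      classical
      have hcard : ((W.erase v).filter fun w => R.Adj v w).card
          + ((W.erase v).filter fun w => ¬ R.Adj v w).card = W.card - 1 := by
        rw [Finset.card_filter_add_card_filter_not, Finset.card_erase_of_mem hv]
      rcases le_total n₁ ((W.erase v).filter fun w => R.Adj v w).card with hn | hn
      · rcases h₁ V R _ hn with ⟨s, hs, hc⟩ | ⟨s, hs, hc⟩
        · refine Or.inl ⟨insert v s, ?_, hc.insert fun b hb => (Finset.mem_filter.1 (hs hb)).2⟩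
          exact Finset.insert_subset hv fun x hx =>
            Finset.mem_of_mem_erase (Finset.mem_filter.1 (hs hx)).1
        · exact Or.inr ⟨s, fun x hx =>
            Finset.mem_of_mem_erase (Finset.mem_filter.1 (hs hx)).1, hc⟩
      · have hn' : n₂ ≤ ((W.erase v).filter fun w => ¬ R.Adj v w).card := by omega
        rcases h₂ V R _ hn' with ⟨s, hs, hc⟩ | ⟨s, hs, hc⟩
        · exact Or.inl ⟨s, fun x hx =>
            Finset.mem_of_mem_erase (Finset.mem_filter.1 (hs hx)).1, hc⟩
        · refine Or.inr ⟨insert v s, ?_, hc.insert fun b hb => ?_⟩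
          · exact Finset.insert_subset hv fun x hx =>
              Finset.mem_of_mem_erase (Finset.mem_filter.1 (hs hx)).1
          · have := Finset.mem_filter.1 (hs hb)
            exact (SimpleGraph.compl_adj _ _ _).2 ⟨(Finset.ne_of_mem_erase this.1).symm, this.2⟩

/-- A good colouring restricts to every smaller vertex set, in particular to one of size
`ramseyNumber l k`. Finiteness of the Ramsey number is needed because `sInf ∅ = 0`. -/
theorem lt_ramseyNumber {l k N : ℕ} (R : SimpleGraph (Fin N))
    (h₁ : ¬ ∃ s : Finset (Fin N), R.IsNClique l s)
    (h₂ : ¬ ∃ s : Finset (Fin N), Rᶜ.IsNClique k s) : N < ramseyNumber l k := by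
  have hne : {n : ℕ | 0 < n ∧ ∀ R : SimpleGraph (Fin n),
      (∃ s : Finset (Fin n), R.IsNClique l s) ∨ (∃ s : Finset (Fin n), Rᶜ.IsNClique k s)}.Nonempty := by
    obtain ⟨n, hn⟩ := exists_ramsey_bound l k
    refine ⟨n + 1, Nat.succ_pos _, fun R => ?_⟩
    rcases hn (Fin (n + 1)) R Finset.univ (by simp) with ⟨s, _, hs⟩ | ⟨s, _, hs⟩
    · exact Or.inl ⟨s, hs⟩
    · exact Or.inr ⟨s, hs⟩
  by_contra! hle
  have hmem := (Nat.sInf_mem hne).2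
  change ramseyNumber l k ≤ N at hle
  change ∀ R : SimpleGraph (Fin (ramseyNumber l k)), _ at hmem
  set f : Fin (ramseyNumber l k) ↪ Fin N := (Fin.castLEEmb hle) with hf
  have hmap : ∀ (G : SimpleGraph (Fin N)) (H : SimpleGraph (Fin (ramseyNumber l k))) (n : ℕ)
      (s : Finset (Fin (ramseyNumber l k))), (∀ i j, H.Adj i j → G.Adj (f i) (f j)) →
      H.IsNClique n s → G.IsNClique n (s.map f) := by
    intro G H n s hGH hs
    rw [SimpleGraph.isNClique_iff] at hs ⊢
    refine ⟨?_, by rw [Finset.card_map]; exact hs.2⟩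
    intro x hx y hy hxy
    simp only [Finset.coe_map, mem_image, Finset.mem_coe] at hx hy
    obtain ⟨i, hi, rfl⟩ := hx
    obtain ⟨j, hj, rfl⟩ := hy
    exact hGH i j (hs.1 hi hj fun h => hxy (by rw [h]))
  rcases hmem (R.comap f) with ⟨s, hs⟩ | ⟨s, hs⟩
  · exact h₁ ⟨_, hmap R _ l s (fun i j h => h) hs⟩
  · refine h₂ ⟨_, hmap Rᶜ _ k s (fun i j h => ?_) hs⟩
    have h' := (SimpleGraph.compl_adj (R.comap f) i j).1 h
    exact (SimpleGraph.compl_adj _ _ _).2 ⟨fun e => h'.1 (f.injective e), h'.2⟩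

/-! ### The balanced edge probability and the hazard gap -/

/-- The difference of the two sides has derivative `1 - 2H`, with `H` the binary entropy. Since `H`
increases strictly on `[0, 1/2]`, the difference is strictly concave there; it vanishes at both
endpoints, hence is positive between them. -/
theorem sq_mul_neg_log_lt {p : ℝ} (hp0 : 0 < p) (hp1 : p < 1 / 2) :
    p ^ 2 * -Real.log p < (1 - p) ^ 2 * -Real.log (1 - p) := by
  set h : ℝ → ℝ := fun x => (1 - x) * Real.negMulLog (1 - x) - x * Real.negMulLog x with hh
  have hcont : Continuous h := by
    have := Real.continuous_negMulLog
    fun_prop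
  have hd : ∀ x ∈ Ioo (0 : ℝ) (1 / 2), HasDerivAt h (1 - 2 * Real.binEntropy x) x := by
    intro x hx
    have hx0 : x ≠ 0 := hx.1.ne'
    have hx1 : 1 - x ≠ 0 := by linarith [hx.2]
    have h1 := (hasDerivAt_id' x).mul (Real.hasDerivAt_negMulLog hx0)
    have h3 : HasDerivAt (fun x : ℝ => 1 - x) (-1) x := by
      simpa using (hasDerivAt_id' x).const_sub 1
    have h2 := h3.mul ((Real.hasDerivAt_negMulLog hx1).comp x h3)
    have h4 := h2.sub h1
    refine h4.congr_deriv ?_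
    simp only [Real.binEntropy_eq_negMulLog_add_negMulLog_one_sub, Real.negMulLog,
      Function.comp_apply]
    ring
  have hconc : StrictConcaveOn ℝ (Icc 0 (1 / 2)) h := by
    refine StrictAntiOn.strictConcaveOn_of_deriv (convex_Icc _ _) hcont.continuousOn ?_
    rw [interior_Icc]
    intro x hx y hy hxy
    rw [(hd x hx).deriv, (hd y hy).deriv]
    have := Real.binEntropy_strictMonoOn (a := x) (b := y) ⟨hx.1.le, by linarith [hx.2]⟩
      ⟨hy.1.le, by linarith [hy.2]⟩ hxy
    linarith
  have h0 : h 0 = 0 := by simp [hh]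
  have h1 : h (1 / 2) = 0 := by norm_num [hh]
  have hlt := hconc.2 (show (0 : ℝ) ∈ Icc 0 (1 / 2) by simp) (show (1 / 2 : ℝ) ∈ Icc 0 (1 / 2) by simp)
    (by norm_num) (show 0 < 1 - 2 * p by linarith) (show 0 < 2 * p by linarith) (by ring)
  rw [h0, h1] at hlt
  have e : (1 - 2 * p) • (0 : ℝ) + (2 * p) • (1 / 2 : ℝ) = p := by simp; ring
  rw [e] at hlt
  simp only [smul_zero, add_zero, hh, Real.negMulLog] at hlt
  nlinarith

theorem exists_balanced_probability {lam : ℝ} (h0 : 0 < lam) (h1 : lam < 1) :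
    ∃ p : ℝ, lam * Real.log 2 / 2 ≤ p ∧ p ≤ 1 / 2 ∧ Real.log (1 - p) = lam * Real.log p := by
  have hl2 : Real.log 2 < 1 := by linarith [Real.log_two_lt_d9]
  have hl0 : 0 < Real.log 2 := Real.log_pos one_lt_two
  -- Chosen so that `2x = lam * log 2`: then `log(1-x) ≥ -2x` and `log x ≤ -log 2` give the sign
  -- needed at the left end.
  set x := lam * Real.log 2 / 2 with hx
  have hx0 : 0 < x := by positivity
  have hx1 : x ≤ 1 / 2 := by rw [hx]; nlinarith
  have hc : ContinuousOn (fun p : ℝ => Real.log (1 - p) - lam * Real.log p) (Icc x (1 / 2)) := by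
    refine ContinuousOn.sub (ContinuousOn.log (by fun_prop) ?_)
      (continuousOn_const.mul (ContinuousOn.log (by fun_prop) ?_))
    · intro p hp; linarith [hp.2]
    · intro p hp; linarith [hp.1]
  have hleft : 0 ≤ Real.log (1 - x) - lam * Real.log x := by
    have e1 : -(2 * x) ≤ Real.log (1 - x) := by
      have := Real.one_sub_inv_le_log_of_pos (show 0 < 1 - x by linarith)
      refine le_trans ?_ this
      have : (1 - x)⁻¹ ≤ 1 + 2 * x := by
        rw [inv_le_iff_one_le_mul₀ (by linarith)]
        nlinarith
      linarith
    have e2 : Real.log x ≤ -Real.log 2 := by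
      rw [← Real.log_inv]
      exact Real.log_le_log hx0 (by linarith)
    nlinarith
  have hright : Real.log (1 - 1 / 2) - lam * Real.log (1 / 2) ≤ 0 := by
    have : Real.log (1 / 2) = -Real.log 2 := by rw [one_div, Real.log_inv]
    rw [show (1 : ℝ) - 1 / 2 = 1 / 2 by norm_num, this]
    nlinarith
  obtain ⟨p, hp, hpe⟩ := intermediate_value_Icc' hx1 hc ⟨hright, hleft⟩
  exact ⟨p, hp.1, hp.2, by simp only at hpe; linarith⟩

/-- Keeps `p` away from `1/2`, where the gap vanishes: `log((1-p)/p) = (1 - lam)(-log p)` is at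
least `δ log 2` and at most `(1-2p)/p`. -/
theorem balanced_probability_gap {lam δ p : ℝ} (hδ0 : 0 < δ) (h1 : lam ≤ 1 - δ)
    (hp0 : 0 < p) (hp1 : p ≤ 1 / 2) (hp : Real.log (1 - p) = lam * Real.log p) :
    δ * Real.log 2 * p ≤ 1 - 2 * p := by
  have hlp : Real.log p ≤ -Real.log 2 := by
    rw [← Real.log_inv]
    exact Real.log_le_log hp0 (by linarith)
  have e1 : Real.log ((1 - p) / p) ≤ (1 - p) / p - 1 :=
    Real.log_le_sub_one_of_pos (div_pos (by linarith) hp0)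
  rw [Real.log_div (by linarith) hp0.ne'] at e1
  have e2 : (1 - p) / p - 1 = (1 - 2 * p) / p := by field_simp; ring
  have e3 : δ * Real.log 2 ≤ Real.log (1 - p) - Real.log p := by
    have hl0 : 0 < Real.log 2 := Real.log_pos one_lt_two
    rw [hp]
    nlinarith
  rw [e2, le_div_iff₀ hp0] at e1
  exact (mul_le_mul_of_nonneg_right e3 hp0.le).trans e1

theorem exists_gap_sq_mul_neg_log {x y : ℝ} (hx : 0 < x) (hy : y < 1 / 2) :
    ∃ g : ℝ, 0 < g ∧ ∀ p ∈ Icc x y, g ≤ (1 - p) ^ 2 * -Real.log (1 - p) - p ^ 2 * -Real.log p := by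
  rcases (Icc x y).eq_empty_or_nonempty with he | hne
  · exact ⟨1, one_pos, by simp [he]⟩
  · have hc : ContinuousOn (fun p : ℝ => (1 - p) ^ 2 * -Real.log (1 - p) - p ^ 2 * -Real.log p)
        (Icc x y) := by
      refine ContinuousOn.sub (ContinuousOn.mul (by fun_prop)
        (ContinuousOn.log (by fun_prop) ?_).neg)
        (ContinuousOn.mul (by fun_prop) (ContinuousOn.log (by fun_prop) ?_).neg)
      · intro p hp; linarith [hp.2]
      · intro p hp; linarith [hp.1]
    obtain ⟨p₀, hp₀, hmin⟩ := isCompact_Icc.exists_isMinOn hne hc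
    refine ⟨_, sub_pos.2 (sq_mul_neg_log_lt (lt_of_lt_of_le hx hp₀.1) (lt_of_le_of_lt hp₀.2 hy)),
      fun p hp => hmin hp⟩

/-- Translates the logarithmic inequality, read with `t = log p` and `lam * t = log(1-p)`, into
hazard rates: the right side is `d² w/(p(1-p))²` with `w = lam (1-p)² - p²`, and the hypothesis `h`
bounds `w` below. -/
theorem hazard_gap {p lam f d g₀ t s : ℝ} (hp0 : 0 < p) (hp1 : p ≤ 1 / 2) (hf : 0 < f)
    (hd : f ≤ d) (hg : 0 < g₀) (ht : t < 0) (hst : s ≤ t)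
    (h : g₀ ≤ (lam * (1 - p) ^ 2 - p ^ 2) * -t) :
    f ^ 2 * (g₀ / -s) ≤ lam * (d / p) ^ 2 - (d / (1 - p)) ^ 2 := by
  have hq : 0 < 1 - p := by linarith
  set w := lam * (1 - p) ^ 2 - p ^ 2 with hw
  have hs : 0 < -s := by linarith
  have hw0 : 0 ≤ w := by
    by_contra! hneg
    have := mul_neg_of_neg_of_pos hneg (neg_pos.2 ht)
    linarith
  have h1 : g₀ / -s ≤ w := by
    rw [div_le_iff₀ hs]
    exact h.trans (mul_le_mul_of_nonneg_left (by linarith) hw0)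
  have h2 : lam * (d / p) ^ 2 - (d / (1 - p)) ^ 2 = d ^ 2 * (w / (p * (1 - p)) ^ 2) := by
    rw [hw]; field_simp
  have h3 : w ≤ w / (p * (1 - p)) ^ 2 := by
    rw [le_div_iff₀ (by positivity)]
    have h4 : p * (1 - p) ≤ 1 := by nlinarith
    exact mul_le_of_le_one_right hw0 (pow_le_one₀ (by positivity) h4)
  rw [h2]
  exact mul_le_mul (by gcongr) (h1.trans h3) (by positivity) (sq_nonneg _)

/-- The threshold with balanced clique counts, together with uniform bounds for the quantities
that depend on it. -/
theorem exists_balanced_threshold {δ : ℝ} (hδ0 : 0 < δ) :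
    ∃ M g : ℝ, 1 ≤ M ∧ 0 < g ∧ ∀ lam : ℝ, δ ≤ lam → lam ≤ 1 - δ → ∃ a : ℝ,
      Real.log (gaussianTail (-a)) = lam * Real.log (gaussianTail a) ∧
      -M ≤ Real.log (gaussianTail a) ∧
      |Real.log (gaussianTail a) + gaussianHazard a * a| ≤ M ∧
      |Real.log (gaussianTail (-a)) + gaussianHazard (-a) * (-a)| ≤ M ∧
      g ≤ gaussianHazard a ∧ gaussianHazard a ≤ M ∧
      g ≤ gaussianHazard (-a) ∧ gaussianHazard (-a) ≤ M ∧
      g ≤ lam * gaussianHazard a ^ 2 - gaussianHazard (-a) ^ 2 := by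
  have hl0 : 0 < Real.log 2 := Real.log_pos one_lt_two
  have hl2 : Real.log 2 < 1 := by linarith [Real.log_two_lt_d9]
  set x := min (δ * Real.log 2 / 2) (1 / 4) with hx
  have hx0 : 0 < x := by positivity
  have hx1 : x ≤ 1 / 4 := min_le_right _ _
  have hxδ : x ≤ δ * Real.log 2 / 2 := min_le_left _ _
  set y := (1 - δ * Real.log 2 * x) / 2 with hy
  have hy1 : y < 1 / 2 := by
    have : 0 < δ * Real.log 2 * x := by positivity
    rw [hy]; linarith
  obtain ⟨g₀, hg₀, hgap⟩ := exists_gap_sq_mul_neg_log hx0 hy1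
  have hlx : 0 < -Real.log x := by
    rw [neg_pos]; exact Real.log_neg hx0 (by linarith)
  -- Makes the Chernoff bound at `A` equal to `x`, so the threshold with tail `p ≥ x` lies in `[0,
  -- A]`.
  set A := √(2 * -Real.log x) with hA
  have hA0 : 0 ≤ A := Real.sqrt_nonneg _
  have hA2 : A ^ 2 = 2 * -Real.log x := Real.sq_sqrt (by positivity)
  set f := gaussianDensity A with hf
  have hf0 : 0 < f := gaussianDensity_pos A
  have hTA : gaussianTail A ≤ x := by
    refine (gaussianTail_le_exp hA0).trans (le_of_eq ?_)
    rw [neg_div, hA2, mul_div_cancel_left₀ _ two_ne_zero, neg_neg, Real.exp_log hx0]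
  refine ⟨1 + -Real.log x + (1 / x + 2) * (1 + A), min f (f ^ 2 * (g₀ / -Real.log x)), ?_, ?_, ?_⟩
  · have : 0 ≤ (1 / x + 2) * (1 + A) := by positivity
    linarith
  · positivity
  intro lam hlam0 hlam1
  obtain ⟨p, hp0, hp1, hp⟩ := exists_balanced_probability (lt_of_lt_of_le hδ0 hlam0)
    (by linarith : lam < 1)
  have hpx : x ≤ p := by
    refine hxδ.trans (le_trans ?_ hp0)
    gcongr
  have hpp : 0 < p := by linarith
  have hpy : p ≤ y := by
    have h1 := balanced_probability_gap hδ0 hlam1 hpp hp1 hp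
    have h2 : δ * Real.log 2 * x ≤ δ * Real.log 2 * p := by gcongr
    rw [hy]; linarith
  obtain ⟨a, ha, hap⟩ := intermediate_value_Icc' hA0 continuous_gaussianTail.continuousOn
    (show p ∈ Icc (gaussianTail A) (gaussianTail 0) from
      ⟨hTA.trans hpx, by rw [gaussianTail_zero]; exact hp1⟩)
  have haq : gaussianTail (-a) = 1 - p := by rw [gaussianTail_neg, hap]
  have hda : gaussianDensity (-a) = gaussianDensity a := by
    simp only [gaussianDensity_eq, neg_sq]
  have hdf : f ≤ gaussianDensity a := by
    rw [hf, gaussianDensity_eq, gaussianDensity_eq]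
    have : a ^ 2 ≤ A ^ 2 := pow_le_pow_left₀ ha.1 ha.2 2
    gcongr
  have hd1 := gaussianDensity_le_one a
  have hd0 := gaussianDensity_pos a
  have hq : 1 / 2 ≤ 1 - p := by linarith
  have hb1 : gaussianHazard a = gaussianDensity a / p := by rw [gaussianHazard, hap]
  have hb2 : gaussianHazard (-a) = gaussianDensity a / (1 - p) := by
    rw [gaussianHazard, haq, hda]
  have hb1l : f ≤ gaussianHazard a := by
    rw [hb1, le_div_iff₀ hpp]; nlinarith
  have hb2l : f ≤ gaussianHazard (-a) := by
    rw [hb2, le_div_iff₀ (by linarith)]; nlinarith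
  have hb1u : gaussianHazard a ≤ 1 / x := by
    rw [hb1]; gcongr
  have hb2u : gaussianHazard (-a) ≤ 2 := by
    rw [hb2, div_le_iff₀ (by linarith)]; linarith
  have hlogp : Real.log x ≤ Real.log p := Real.log_le_log hx0 hpx
  have hlogp0 : Real.log p < 0 := Real.log_neg hpp (by linarith)
  have hlogq : Real.log x ≤ Real.log (1 - p) := Real.log_le_log hx0 (by linarith)
  have hlogq0 : Real.log (1 - p) ≤ 0 := Real.log_nonpos (by linarith) (by linarith)
  have hix : 0 < 1 / x := by positivity
  have hb1a : gaussianHazard a * a ≤ 1 / x * A :=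
    mul_le_mul hb1u ha.2 ha.1 hix.le
  have hb1a0 : 0 ≤ gaussianHazard a * a := mul_nonneg (by linarith) ha.1
  have hb2a : gaussianHazard (-a) * a ≤ 2 * A :=
    mul_le_mul hb2u ha.2 ha.1 (by norm_num)
  have hb2a0 : 0 ≤ gaussianHazard (-a) * a := mul_nonneg (by linarith) ha.1
  have hixA : 0 ≤ 1 / x * A := by positivity
  have hexp : (1 / x + 2) * (1 + A) = 1 / x + 2 + 1 / x * A + 2 * A := by ring
  have hkey : f ^ 2 * (g₀ / -Real.log x) ≤ lam * gaussianHazard a ^ 2 - gaussianHazard (-a) ^ 2 := by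
    rw [hb1, hb2]
    have h2 := hgap p ⟨hpx, hpy⟩
    rw [hp] at h2
    exact hazard_gap hpp hp1 hf0 hdf hg₀ hlogp0 hlogp (by linarith)
  refine ⟨a, ?_, ?_, ?_, ?_, (min_le_left _ _).trans hb1l, ?_, (min_le_left _ _).trans hb2l, ?_,
    (min_le_right _ _).trans hkey⟩
  · rw [haq, hap, hp]
  · rw [hap]; linarith
  · rw [hap, abs_le]; constructor <;> linarith
  · rw [haq, abs_le]; constructor <;> linarith
  · linarith
  · linarith

/-! ### An upper bound for Erdős's bound -/

/-- If `n + 1` exceeded `2rE` with `E = p^(-r/2) ≥ 1`, then `n + 1 - r ≥ rE`, hence `n.choose r ≥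
E^r`, which is at least `p^(-r.choose 2)`. The lost factor `2r` is harmless against an exponential
gain. -/
theorem le_of_choose_mul_pow_lt_one {n r : ℕ} {p : ℝ} (hr : 0 < r) (hp0 : 0 < p) (hp1 : p ≤ 1)
    (h : (n.choose r : ℝ) * p ^ (r.choose 2) < 1) :
    (n : ℝ) + 1 ≤ 2 * r * Real.exp (-(r / 2 * Real.log p)) := by
  by_contra! hlt
  set E := Real.exp (-(r / 2 * Real.log p)) with hE
  have hlog : Real.log p ≤ 0 := Real.log_nonpos hp0.le hp1
  have hr' : (0 : ℝ) < r := by exact_mod_cast hr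
  have hE1 : 1 ≤ E := Real.one_le_exp (by nlinarith)
  have hrE : (r : ℝ) ≤ r * E := le_mul_of_one_le_right hr'.le hE1
  have hrn : r ≤ n + 1 := by
    have : (r : ℝ) ≤ (n : ℝ) + 1 := by linarith
    exact_mod_cast this
  have hc := Nat.pow_le_choose (α := ℝ) r n
  rw [Nat.cast_sub hrn, div_le_iff₀ (by positivity)] at hc
  push_cast at hc
  have h1 : (r * E) ^ r ≤ (n.choose r : ℝ) * (r : ℝ) ^ r := by
    calc (r * E) ^ r ≤ ((n : ℝ) + 1 - r) ^ r := by gcongr; linarith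
      _ ≤ n.choose r * (Nat.factorial r : ℝ) := hc
      _ ≤ n.choose r * (r : ℝ) ^ r := by
        gcongr
        exact_mod_cast Nat.factorial_le_pow r
  have h2 : E ^ r ≤ n.choose r := by
    rw [mul_pow, mul_comm] at h1
    exact le_of_mul_le_mul_right h1 (by positivity)
  have h3 : 1 ≤ E ^ r * p ^ (r.choose 2) := by
    have e1 : p ^ (r.choose 2) = Real.exp (r * (r - 1) / 2 * Real.log p) := by
      rw [← Nat.cast_choose_two, Real.exp_nat_mul, Real.exp_log hp0]
    rw [e1, hE, ← Real.exp_nat_mul, ← Real.exp_add]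
    refine Real.one_le_exp ?_
    nlinarith
  have h4 : E ^ r * p ^ (r.choose 2) ≤ n.choose r * p ^ (r.choose 2) := by gcongr
  linarith

/-- Whatever probability `q` is used, `q ≥ p` or `1 - q ≥ 1 - p`, so one of the two moments is
already below 1 at `p`. Balance makes both resulting bounds have the same exponential. -/
theorem erdosBound_le {l k : ℕ} {p : ℝ} (hl : 0 < l) (hlk : l ≤ k) (hp0 : 0 < p) (hp1 : p < 1)
    (hp : k * Real.log (1 - p) = l * Real.log p) :
    (erdosBound l k : ℝ) ≤ 2 * k * Real.exp (-(l / 2 * Real.log p)) := by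
  have hk : 0 < k := by omega
  obtain ⟨q, hq0, hq1, hq⟩ := (isGreatest_sSup_firstMomentSet hl hk).1
  rw [erdosBound]
  push_cast
  set n := sSup (firstMomentSet l k)
  unfold firstMoment at hq
  have hA : 0 ≤ (n.choose l : ℝ) * q ^ (l.choose 2) := by positivity
  have hB : 0 ≤ (n.choose k : ℝ) * (1 - q) ^ (k.choose 2) := by
    have : 0 ≤ 1 - q := by linarith
    positivity
  have hlk' : (l : ℝ) ≤ k := by exact_mod_cast hlk
  rcases le_total p q with h | h
  · refine (le_of_choose_mul_pow_lt_one hl hp0 hp1.le ?_).trans ?_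
    · refine lt_of_le_of_lt ?_ (lt_of_le_of_lt (le_add_of_nonneg_right hB) hq)
      gcongr
    · gcongr
  · refine (le_of_choose_mul_pow_lt_one hk (p := 1 - p) (by linarith) (by linarith) ?_).trans ?_
    · refine lt_of_le_of_lt ?_ (lt_of_le_of_lt (le_add_of_nonneg_left hA) hq)
      have : 0 ≤ 1 - p := by linarith
      gcongr
    · refine le_of_eq ?_
      congr 2
      linarith

/-! ### Exponents of the red and blue clique bounds -/

theorem sum_range_sq_bounds (n : ℕ) :
    (n : ℝ) ^ 3 / 3 - n ^ 2 / 2 ≤ ∑ q ∈ Finset.range n, (q : ℝ) ^ 2 ∧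
      ∑ q ∈ Finset.range n, (q : ℝ) ^ 2 ≤ (n : ℝ) ^ 3 / 3 := by
  induction n with
  | zero => simp
  | succ n ih =>
    have : (0 : ℝ) ≤ n := n.cast_nonneg
    rw [Finset.sum_range_succ]
    push_cast
    constructor <;> nlinarith [ih.1, ih.2]

theorem sum_range_cube_le (n : ℕ) : ∑ q ∈ Finset.range n, (q : ℝ) ^ 3 ≤ (n : ℝ) ^ 4 := by
  refine (Finset.sum_le_card_nsmul _ _ ((n : ℝ) ^ 3) fun q hq => ?_).trans (le_of_eq ?_)
  · have : (q : ℝ) ≤ n := by exact_mod_cast (Finset.mem_range.1 hq).le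
    gcongr
  · simp; ring

theorem sum_range_cast (n : ℕ) : ∑ q ∈ Finset.range n, (q : ℝ) = n * (n - 1) / 2 := by
  induction n with
  | zero => simp
  | succ n ih => rw [Finset.sum_range_succ, ih]; push_cast; ring

theorem cliqueConst_le {b M C : ℝ} (hb : 0 ≤ b) (hbM : b ≤ M) (hC : 0 ≤ C) :
    cliqueConst b C ≤ cliqueConst M C := by
  unfold cliqueConst
  gcongr

/-- The probability that the inner products of independent Gaussian vectors in dimension `(D k)²`
all exceed a common value. -/
theorem HasTailBound.measure_clique_le {b κ C M : ℝ} (h : HasTailBound b κ C) (hb : 0 < b)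
    (hbM : b ≤ M) (hC : 0 ≤ C) {ς : ℝ} (hς : ς = 1 ∨ ς = -1) {n k D : ℕ} (hn : 1 ≤ n) (hnk : n ≤ k)
    (hD1 : 1 ≤ D) (hD2 : 2 * M ≤ D) (hD3 : 4 * ((2 * C + 1) * M ^ 2) ≤ D) (t : ℝ) :
    (Measure.pi fun _ : Fin n => gaussianVec ((D * k) ^ 2))
      {x | ∀ i j, i < j → t ≤ ς * (x i ⬝ᵥ x j) / ((D : ℝ) * k)}
    ≤ ENNReal.ofReal (Real.exp (n * cliqueConst M C + n * (n - 1) / 2 * (κ - b * t)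
        + ς * b ^ 3 / (2 * (D * k)) * ∑ q ∈ Finset.range n, (q : ℝ) ^ 2
        + b ^ 4 / (D * k) ^ 2 * n ^ 4)) := by
  have hk : (1 : ℝ) ≤ k := by exact_mod_cast hn.trans hnk
  have hnk' : (n : ℝ) ≤ k := by exact_mod_cast hnk
  have hD : (1 : ℝ) ≤ D := by exact_mod_cast hD1
  have hDk : n ≤ D * k := hnk.trans (Nat.le_mul_of_pos_left k hD1)
  have hsqrt : √(((D * k) ^ 2 : ℕ) : ℝ) = (D : ℝ) * k := by
    push_cast
    exact Real.sqrt_sq (by positivity)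
  -- The dimension `(D k)²` makes `√m` equal to `D k`. The allowance `k` of the inductive lemma is
  -- taken to be `n`, so that the start `d = m` is admissible.
  have hmain := h.measure_inner_ge_le hb hC hς (k := n) (m := (D * k) ^ 2) hn
    (Nat.pow_le_pow_left hDk 2) (by
      rw [hsqrt]
      calc 2 * b * n ≤ 2 * M * n := by gcongr
        _ ≤ D * k := by gcongr) (by
      push_cast
      calc 4 * ((2 * C + 1) * b ^ 2) * (n : ℝ) ≤ 4 * ((2 * C + 1) * M ^ 2) * n := by gcongr
        _ ≤ (D : ℝ) * k := by gcongr
        _ ≤ ((D : ℝ) * k) * (D * k) := le_mul_of_one_le_right (by positivity) (by nlinarith)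
        _ = _ := by ring) n ((D * k) ^ 2) le_rfl le_rfl le_rfl (fun _ _ => t)
  rw [hsqrt] at hmain
  refine hmain.trans (ENNReal.ofReal_le_ofReal (Real.exp_le_exp.2 ?_))
  rw [pairSum_const, Finset.sum_add_distrib, Finset.sum_add_distrib, ← Finset.sum_mul,
    sum_range_cast]
  have e1 : ∑ q ∈ Finset.range n, ς * ((q : ℝ) ^ 2 * b ^ 3 / (2 * (D * k)))
      = ς * b ^ 3 / (2 * (D * k)) * ∑ q ∈ Finset.range n, (q : ℝ) ^ 2 := by
    rw [Finset.mul_sum]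
    exact Finset.sum_congr rfl fun q _ => by ring
  have e2 : ∑ q ∈ Finset.range n, (q : ℝ) ^ 3 * b ^ 4 / (((D * k) ^ 2 : ℕ) : ℝ)
      ≤ b ^ 4 / (D * k) ^ 2 * n ^ 4 := by
    calc ∑ q ∈ Finset.range n, (q : ℝ) ^ 3 * b ^ 4 / (((D * k) ^ 2 : ℕ) : ℝ)
        = b ^ 4 / (D * k) ^ 2 * ∑ q ∈ Finset.range n, (q : ℝ) ^ 3 := by
          rw [Finset.mul_sum]
          exact Finset.sum_congr rfl fun q _ => by push_cast; ring
      _ ≤ _ := by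
          gcongr
          exact sum_range_cube_le n
  have e3 := cliqueConst_le hb.le hbM hC
  have e4 : n * cliqueConst b C ≤ n * cliqueConst M C := by gcongr
  rw [e1]
  linarith

/-- The third-order gain beats the loss from the shift `η/D` because `η` is the midpoint of `b'²/3`
and `(l/k) b²/3`: the net is at most `-2 g² l²/(24D)`. The quartic error is of order `D⁻²`, and the
lower bound on `D` lets it consume only half of this. -/
theorem red_exponent_le {l k D K M P b b' g S : ℝ} (hl : 1 ≤ l) (hlk : l ≤ k) (hD : 1 ≤ D)
    (hg : 0 < g) (hP0 : -M ≤ P) (hgb : g ≤ b) (hbM : b ≤ M)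
    (hgap : g ≤ l / k * b ^ 2 - b' ^ 2) (hDM : 24 * M ^ 4 / g ^ 2 ≤ D)
    (hS : l ^ 3 / 3 - l ^ 2 / 2 ≤ S) :
    l * K + l * (l - 1) / 2 * (P + b * ((l / k * b ^ 2 + b' ^ 2) / 6 / D))
        + -1 * b ^ 3 / (2 * (D * k)) * S + b ^ 4 / (D * k) ^ 2 * l ^ 4
      ≤ l ^ 2 * P / 2 + l * (K + M + M ^ 3) - g ^ 2 / (24 * D) * l ^ 2 := by
  have hk : 0 < k := by linarith
  have hb : 0 < b := by linarith
  have hM : 0 < M := by linarith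
  have hl0 : 0 < l := by linarith
  have hD0 : 0 < D := by linarith
  set lam := l / k with hlam
  have hlk' : l = lam * k := by rw [hlam]; field_simp
  have hlam0 : 0 < lam := by positivity
  have hlam1 : lam ≤ 1 := by rw [hlam, div_le_one hk]; exact hlk
  set η := (lam * b ^ 2 + b' ^ 2) / 6 with hη
  have hη0 : 0 ≤ η := by positivity
  have h1 : -1 * b ^ 3 / (2 * (D * k)) * S
      ≤ -(b ^ 3 * lam * l ^ 2 / (6 * D)) + M ^ 3 * l / 4 := by
    have e1 : b ^ 3 / (2 * (D * k)) * (l ^ 3 / 3 - l ^ 2 / 2) ≤ b ^ 3 / (2 * (D * k)) * S := by gcongr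
    have e2 : b ^ 3 / (2 * (D * k)) * (l ^ 3 / 3 - l ^ 2 / 2)
        = b ^ 3 * lam * l ^ 2 / (6 * D) - b ^ 3 * (l * (lam / D)) / 4 := by
      rw [hlam]; field_simp; ring
    have e3 : b ^ 3 * (l * (lam / D)) ≤ M ^ 3 * (l * 1) := by
      have : lam / D ≤ 1 := by rw [div_le_one hD0]; linarith
      gcongr
    have e4 : -1 * b ^ 3 / (2 * (D * k)) * S = -(b ^ 3 / (2 * (D * k)) * S) := by ring
    rw [e4]
    linarith
  have h2 : b ^ 4 / (D * k) ^ 2 * l ^ 4 ≤ g ^ 2 / (24 * D) * l ^ 2 := by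
    have e1 : b ^ 4 / (D * k) ^ 2 * l ^ 4 = b ^ 4 * lam ^ 2 / D ^ 2 * l ^ 2 := by
      rw [hlam]; field_simp
    rw [e1]
    gcongr ?_ * l ^ 2
    rw [div_le_iff₀ (by positivity)] at hDM ⊢
    have e2 : g ^ 2 / (24 * D) * D ^ 2 = D * g ^ 2 / 24 := by field_simp
    have e3 : b ^ 4 * lam ^ 2 ≤ M ^ 4 * 1 := by
      have : lam ^ 2 ≤ 1 := pow_le_one₀ hlam0.le hlam1
      gcongr
    rw [e2]
    linarith
  have h3 : l * (l - 1) / 2 * (P + b * (η / D)) ≤ l ^ 2 * P / 2 + l * M / 2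
      + l ^ 2 * b * η / (2 * D) := by
    have e1 : l * (l - 1) / 2 * (P + b * (η / D))
        = l ^ 2 * P / 2 + l * (-P) / 2 + l ^ 2 * b * η / (2 * D) - l * (b * (η / D)) / 2 := by
      field_simp; ring
    have e2 : l * (-P) ≤ l * M := by gcongr; linarith
    have e3 : 0 ≤ l * (b * (η / D)) := by positivity
    linarith
  have h4 : l ^ 2 * b * η / (2 * D) - b ^ 3 * lam * l ^ 2 / (6 * D)
      ≤ -(2 * (g ^ 2 / (24 * D) * l ^ 2)) := by
    have e1 : l ^ 2 * b * η / (2 * D) - b ^ 3 * lam * l ^ 2 / (6 * D)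
        = -(l ^ 2 / (12 * D) * (b * (lam * b ^ 2 - b' ^ 2))) := by
      rw [hη]; field_simp; ring
    have e2 : g * g ≤ b * (lam * b ^ 2 - b' ^ 2) := mul_le_mul hgb hgap hg.le hb.le
    have e3 : 2 * (g ^ 2 / (24 * D) * l ^ 2) = l ^ 2 / (12 * D) * (g * g) := by field_simp; ring
    rw [e1, e3]
    have : l ^ 2 / (12 * D) * (g * g) ≤ l ^ 2 / (12 * D) * (b * (lam * b ^ 2 - b' ^ 2)) := by gcongr
    linarith
  have h5 : 0 ≤ M ^ 3 * l := by positivity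
  have h6 : 0 ≤ l * M := by positivity
  linarith

/-- The mirror image: here `b` is the blue hazard rate and `b'` the red one. The gain from the
threshold shift beats the third-order loss, by the same margin. -/
theorem blue_exponent_le {k D K M P lam b b' g S : ℝ} (hk : 1 ≤ k) (hD : 1 ≤ D)
    (hlam0 : 0 ≤ lam) (hlam1 : lam ≤ 1) (hg : 0 < g) (hP0 : -M ≤ P) (hgb : g ≤ b) (hbM : b ≤ M)
    (hgb' : g ≤ b') (hbM' : b' ≤ M) (hgap : g ≤ lam * b' ^ 2 - b ^ 2)
    (hDM : 24 * M ^ 4 / g ^ 2 ≤ D) (hS : S ≤ k ^ 3 / 3) :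
    k * K + k * (k - 1) / 2 * (P - b * ((lam * b' ^ 2 + b ^ 2) / 6 / D))
        + 1 * b ^ 3 / (2 * (D * k)) * S + b ^ 4 / (D * k) ^ 2 * k ^ 4
      ≤ k ^ 2 * P / 2 + k * (K + M + M ^ 3) - g ^ 2 / (24 * D) * k ^ 2 := by
  have hk0 : 0 < k := by linarith
  have hb : 0 < b := by linarith
  have hb' : 0 < b' := by linarith
  have hM : 0 < M := by linarith
  have hD0 : 0 < D := by linarith
  set η := (lam * b' ^ 2 + b ^ 2) / 6 with hη
  have hη0 : 0 ≤ η := by positivity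
  have hηM : η ≤ M ^ 2 := by
    have e1 : lam * b' ^ 2 ≤ 1 * M ^ 2 := by gcongr
    have e2 : b ^ 2 ≤ M ^ 2 := by gcongr
    rw [hη]
    nlinarith [sq_nonneg M]
  have h1 : 1 * b ^ 3 / (2 * (D * k)) * S ≤ b ^ 3 * k ^ 2 / (6 * D) := by
    calc 1 * b ^ 3 / (2 * (D * k)) * S ≤ 1 * b ^ 3 / (2 * (D * k)) * (k ^ 3 / 3) := by gcongr
      _ = _ := by field_simp; ring
  have h2 : b ^ 4 / (D * k) ^ 2 * k ^ 4 ≤ g ^ 2 / (24 * D) * k ^ 2 := by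
    have e1 : b ^ 4 / (D * k) ^ 2 * k ^ 4 = b ^ 4 / D ^ 2 * k ^ 2 := by field_simp
    rw [e1]
    gcongr ?_ * k ^ 2
    rw [div_le_iff₀ (by positivity)] at hDM ⊢
    have e2 : g ^ 2 / (24 * D) * D ^ 2 = D * g ^ 2 / 24 := by field_simp
    have e3 : b ^ 4 ≤ M ^ 4 := by gcongr
    rw [e2]
    linarith
  have h3 : k * (k - 1) / 2 * (P - b * (η / D)) ≤ k ^ 2 * P / 2 + k * M / 2
      - k ^ 2 * b * η / (2 * D) + k * M ^ 3 / 2 := by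
    have e1 : k * (k - 1) / 2 * (P - b * (η / D))
        = k ^ 2 * P / 2 + k * (-P) / 2 - k ^ 2 * b * η / (2 * D) + k * (b * (η / D)) / 2 := by
      field_simp; ring
    have e2 : k * (-P) ≤ k * M := by gcongr; linarith
    have e3 : k * (b * (η / D)) ≤ k * (M * M ^ 2) := by
      have : η / D ≤ M ^ 2 := (div_le_self hη0 hD).trans hηM
      gcongr
    linarith
  have h4 : -(k ^ 2 * b * η / (2 * D)) + b ^ 3 * k ^ 2 / (6 * D)
      ≤ -(2 * (g ^ 2 / (24 * D) * k ^ 2)) := by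
    have e1 : -(k ^ 2 * b * η / (2 * D)) + b ^ 3 * k ^ 2 / (6 * D)
        = -(k ^ 2 / (12 * D) * (b * (lam * b' ^ 2 - b ^ 2))) := by
      rw [hη]; field_simp; ring
    have e2 : g * g ≤ b * (lam * b' ^ 2 - b ^ 2) := mul_le_mul hgb hgap hg.le hb.le
    have e3 : 2 * (g ^ 2 / (24 * D) * k ^ 2) = k ^ 2 / (12 * D) * (g * g) := by field_simp; ring
    rw [e1, e3]
    have : k ^ 2 / (12 * D) * (g * g) ≤ k ^ 2 / (12 * D) * (b * (lam * b' ^ 2 - b ^ 2)) := by gcongr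
    linarith
  have h5 : 0 ≤ M ^ 3 * k := by positivity
  have h6 : 0 ≤ k * M := by positivity
  linarith

theorem HasTailBound.mono {b κ C C' : ℝ} (h : HasTailBound b κ C) (hC : C ≤ C') :
    HasTailBound b κ C' := fun s t hs =>
  (h s t hs).trans (Real.exp_le_exp.2 (by gcongr))

theorem hasTailBound_gaussianHazard {a M g : ℝ} (hg : 0 < g) (hM : 0 ≤ M)
    (hgb : g ≤ gaussianHazard a)
    (hκ : |Real.log (gaussianTail a) + gaussianHazard a * a| ≤ M) :
    HasTailBound (gaussianHazard a) (Real.log (gaussianTail a) + gaussianHazard a * a)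
      (2 + M / g ^ 2) :=
  (hasTailBound_of_tangent (gaussianHazard_pos a) (gaussianTail_le_tangent a)).mono (by gcongr)

/-! ### Assembly of the main theorem -/

/-- Few vertices, each clique with small probability: the first moment is small. -/
theorem choose_mul_ofReal_exp_lt {N n : ℕ} {X x R : ℝ} (hNX : (N : ℝ) ≤ X) (hX : X ≤ Real.exp x)
    (hn : 1 ≤ n) (hR : n * x + R ≤ -n) :
    (N.choose n : ℝ≥0∞) * ENNReal.ofReal (Real.exp R) < ENNReal.ofReal (1 / 2) := by
  have h1 : (N.choose n : ℝ) ≤ Real.exp (n * x) := by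
    rw [Real.exp_nat_mul]
    have h2 : (N.choose n : ℝ) ≤ (N : ℝ) ^ n := by exact_mod_cast Nat.choose_le_pow N n
    exact h2.trans (pow_le_pow_left₀ N.cast_nonneg (hNX.trans hX) n)
  have hn' : (1 : ℝ) ≤ n := by exact_mod_cast hn
  rw [← ENNReal.ofReal_natCast, ← ENNReal.ofReal_mul (Nat.cast_nonneg _)]
  refine (ENNReal.ofReal_lt_ofReal_iff (by norm_num)).2 ?_
  calc (N.choose n : ℝ) * Real.exp R ≤ Real.exp (n * x) * Real.exp R := by gcongr
    _ = Real.exp (n * x + R) := by rw [Real.exp_add]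
    _ ≤ Real.exp (-1) := Real.exp_le_exp.2 (by linarith)
    _ < 1 / 2 := by
      rw [Real.exp_neg, one_div]
      exact inv_strictAnti₀ two_pos (by linarith [Real.exp_one_gt_d9])

theorem mainTheorem2 (δ : ℝ) (hδ0 : 0 < δ) (hδ1 : δ < 1 / 2) :
    ∃ c : ℝ, 0 < c ∧ ∀ l k : ℕ,
      δ ≤ (l : ℝ) / (k : ℝ) → (l : ℝ) / (k : ℝ) ≤ 1 - δ → 1 / c ≤ (l : ℝ) →
        (1 + c) ^ l * (erdosBound l k : ℝ) ≤ (ramseyNumber l k : ℝ) := by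
  obtain ⟨M, g, hM1, hg, hbal⟩ := exists_balanced_threshold hδ0
  have hM0 : 0 ≤ M := by linarith
  set C : ℝ := 2 + M / g ^ 2 with hC
  have hC0 : 0 ≤ C := by positivity
  set K := cliqueConst M C
  obtain ⟨D, hD⟩ := exists_nat_ge
    (1 + 2 * M + 4 * ((2 * C + 1) * M ^ 2) + 24 * M ^ 4 / g ^ 2)
  have hq1 : 0 ≤ 4 * ((2 * C + 1) * M ^ 2) := by positivity
  have hq2 : 0 ≤ 24 * M ^ 4 / g ^ 2 := by positivity
  have hD1 : (1 : ℝ) ≤ D := by linarith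
  have hD1' : 1 ≤ D := by exact_mod_cast hD1
  have hD0 : (0 : ℝ) < D := by linarith
  set s : ℝ := g ^ 2 / (24 * D) with hs
  have hs0 : 0 < s := by positivity
  set K' : ℝ := K + M + M ^ 3 with hK'
  -- Solves `log(2k) + K' + 1 ≤ s l/2` for `l`, using `k ≤ l/δ` and `log l ≤ s l/4 - log(s/4)`. One
  -- half of the saving `s l` pays for these terms, the other half for `(1+c)^l`.
  set L₁ : ℝ := 4 / s * (K' + 1 + Real.log (2 / δ) - Real.log (s / 4)) with hL₁
  refine ⟨min (s / 2) (1 / max L₁ 1), by positivity, fun l k h1 h2 h3 => ?_⟩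
  set c := min (s / 2) (1 / max L₁ 1) with hc
  have hc0 : 0 < c := by positivity
  have hcs : c ≤ s / 2 := min_le_left _ _
  have hlL : max L₁ 1 ≤ l := by
    refine le_trans ?_ h3
    rw [le_one_div (by positivity) hc0]
    exact min_le_right _ _
  have hl1 : (1 : ℝ) ≤ l := (le_max_right _ _).trans hlL
  have hl1' : 1 ≤ l := by exact_mod_cast hl1
  have hk0 : (0 : ℝ) < k := by
    -- For `k = 0` the quotient `l/k` is 0 by convention, against `δ ≤ l/k`.
    rcases Nat.eq_zero_or_pos k with h | h
    · rw [h] at h1; simp at h1; linarith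
    · exact_mod_cast h
  have hlk : (l : ℝ) ≤ k := by
    rw [div_le_iff₀ hk0] at h2
    nlinarith
  have hlk' : l ≤ k := by exact_mod_cast hlk
  have hk1 : (1 : ℝ) ≤ k := hl1.trans hlk
  have hkl : (k : ℝ) ≤ l / δ := by
    rw [le_div_iff₀ hδ0]
    rw [le_div_iff₀ hk0] at h1
    linarith
  obtain ⟨a, hlog, hP, hκ₁, hκ₂, hgb₁, hbM₁, hgb₂, hbM₂, hgap⟩ := hbal _ h1 h2
  set P := Real.log (gaussianTail a)
  set Q := Real.log (gaussianTail (-a))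
  set b₁ := gaussianHazard a
  set b₂ := gaussianHazard (-a)
  have hP0 : P ≤ 0 := Real.log_nonpos (gaussianTail_pos a).le (gaussianTail_le_one a)
  have hlam0 : 0 ≤ (l : ℝ) / k := by positivity
  have hlam1 : (l : ℝ) / k ≤ 1 := by linarith
  have hQM : -M ≤ Q := by rw [hlog]; nlinarith
  have hkQ : k * Q = l * P := by rw [hlog]; field_simp
  set η : ℝ := ((l : ℝ) / k * b₁ ^ 2 + b₂ ^ 2) / 6 with hη
  -- The target: `(1+c)^l` times the upper bound for `erdosBound l k`. A good colouring on `⌊X⌋`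
  -- vertices suffices, since `r ≥ ⌊X⌋ + 1 > X`.
  set X : ℝ := (1 + c) ^ l * (2 * k * Real.exp (-(l / 2 * P))) with hX
  have hX0 : 0 ≤ X := by positivity
  set N := ⌊X⌋₊
  have hNX : (N : ℝ) ≤ X := Nat.floor_le hX0
  have hXexp : X ≤ Real.exp (c * l + Real.log (2 * k) - l / 2 * P) := by
    rw [sub_eq_add_neg, Real.exp_add, Real.exp_add, Real.exp_log (by positivity), hX,
      mul_comm c, Real.exp_nat_mul, ← mul_assoc]
    have : 1 + c ≤ Real.exp c := by linarith [Real.add_one_le_exp c]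
    gcongr
  have hlarge : Real.log (2 * k) + K' + 1 ≤ s / 2 * l := by
    have e1 : Real.log (2 * k) ≤ Real.log (2 / δ) + Real.log l := by
      rw [← Real.log_mul (by positivity) (by positivity)]
      refine Real.log_le_log (by positivity) ?_
      calc (2 : ℝ) * k ≤ 2 * (l / δ) := by gcongr
        _ = _ := by ring
    have e2 : Real.log l + Real.log (s / 4) ≤ s / 4 * l := by
      rw [← Real.log_mul (by positivity) (by positivity)]
      refine (Real.log_le_sub_one_of_pos (by positivity)).trans ?_
      linarith
    have e3 : K' + 1 + Real.log (2 / δ) - Real.log (s / 4) ≤ s / 4 * l := by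
      have := (le_max_left L₁ 1).trans hlL
      rw [hL₁, div_mul_eq_mul_div, div_le_iff₀ hs0] at this
      linarith
    linarith
  have hred := (hasTailBound_gaussianHazard hg hM0 hgb₁ hκ₁).measure_clique_le
    (gaussianHazard_pos a) hbM₁ hC0 (Or.inr rfl) hl1' hlk' hD1' (by linarith) (by linarith)
    (a - η / D)
  have hblue := (hasTailBound_gaussianHazard hg hM0 hgb₂ hκ₂).measure_clique_le
    (gaussianHazard_pos (-a)) hbM₂ hC0 (Or.inl rfl) (hl1'.trans hlk') le_rfl hD1' (by linarith)
    (by linarith) (-(a - η / D))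
  have hsmall : (N.choose l : ℝ≥0∞) * (Measure.pi fun _ : Fin l => gaussianVec ((D * k) ^ 2))
        {x | ∀ i j, i < j → (a - η / D) ≤ -1 * (x i ⬝ᵥ x j) / ((D : ℝ) * k)}
      + N.choose k * (Measure.pi fun _ : Fin k => gaussianVec ((D * k) ^ 2))
        {x | ∀ i j, i < j → -(a - η / D) ≤ 1 * (x i ⬝ᵥ x j) / ((D : ℝ) * k)} < 1 := by
    have hhalf : (1 : ℝ≥0∞) = ENNReal.ofReal (1 / 2) + ENNReal.ofReal (1 / 2) := by
      rw [← ENNReal.ofReal_add (by norm_num) (by norm_num)]; norm_num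
    rw [hhalf]
    refine ENNReal.add_lt_add ?_ ?_
    · refine lt_of_le_of_lt (mul_le_mul_right hred _)
        (choose_mul_ofReal_exp_lt hNX hXexp hl1' ?_)
      have := red_exponent_le (K := K) hl1 hlk hD1 hg hP hgb₁ hbM₁ hgap (by linarith)
        (sum_range_sq_bounds l).1
      rw [← hη] at this
      have e1 : P + b₁ * a - b₁ * (a - η / D) = P + b₁ * (η / D) := by ring
      rw [e1]
      have e2 : c * l ≤ s / 2 * l := by gcongr
      have e3 : l * (c * l + Real.log (2 * k) + K' - s * l) ≤ l * (-1) := by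
        gcongr; linarith
      linarith
    · refine lt_of_le_of_lt (mul_le_mul_right hblue _)
        (choose_mul_ofReal_exp_lt hNX hXexp (hl1'.trans hlk') ?_)
      have := blue_exponent_le (K := K) hk1 hD1 hlam0 hlam1 hg hQM hgb₂ hbM₂ hgb₁ hbM₁ hgap
        (by linarith) (sum_range_sq_bounds k).2
      rw [← hη] at this
      have e1 : Q + b₂ * (-a) - b₂ * (-(a - η / D)) = Q - b₂ * (η / D) := by ring
      rw [e1]
      have e2 : c * l ≤ s / 2 * k := by gcongr
      have e4 : s / 2 * l ≤ s / 2 * k := by gcongr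
      have e3 : k * (c * l + Real.log (2 * k) + K' - s * k) ≤ k * (-1) := by
        gcongr; linarith
      -- Balance again: the blue main term cancels the same vertex count as the red one.
      have e5 : (k : ℝ) ^ 2 * Q / 2 = k * (l / 2 * P) := by
        calc (k : ℝ) ^ 2 * Q / 2 = k * (k * Q) / 2 := by ring
          _ = _ := by rw [hkQ]; ring
      linarith
  obtain ⟨R, hR₁, hR₂⟩ := exists_graph_of_measure_lt_one _ _ hsmall
  have hram : (N : ℝ) + 1 ≤ ramseyNumber l k := by exact_mod_cast lt_ramseyNumber R hR₁ hR₂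
  have hEr : (erdosBound l k : ℝ) ≤ 2 * k * Real.exp (-(l / 2 * P)) := by
    have hlt : gaussianTail a < 1 := by
      have := gaussianTail_neg a
      linarith [gaussianTail_pos (-a)]
    refine erdosBound_le hl1' hlk' (gaussianTail_pos a) hlt ?_
    rw [← gaussianTail_neg]
    exact hkQ
  calc (1 + c) ^ l * (erdosBound l k : ℝ) ≤ X := by rw [hX]; gcongr
    _ ≤ N + 1 := (Nat.lt_floor_add_one X).le
    _ ≤ _ := hram
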